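/- Conventions. All objects are smooth. Let $f\colon M^2\to\mathbb{R}^N$ be an immersion of a 2-manifold, with the induced metric, second fundamental form $\alpha_f$ and shape operators $A_\xi$. The normal bundle is flat if the curvature of the normal connection vanishes; $p$ is umbilic if there is a vector $H$ with $\alpha_f(X,Y)=\langle X,Y\rangle H$ for all $X,Y\in T_pM$; a principal direction is a common eigenvector of all $A_\xi$; a curvature line is a curve that is everywhere tangent to a principal direction. If the normal bundle is flat and there are no umbilics, there are exactly two orthogonal families of curvature lines. A local isothermic parametrization by curvature lines is a diffeomorphism $\psi\colon J_1\times J_2\to U$ from a product of two open intervals onto an open set $U\subset M^2$ such that $(f\circ\psi)^*\langle\,,\,\rangle=\varphi^2(ds^2+dt^2)$ with $\varphi>0$ and the coordinate curves of $\psi$ are curvature lines of $f$ (the order of the two families is free). An inversion in $\mathbb{R}^N$ is the inversion in a sphere of some radius $r>0$ or, hyperplanes being counted as spheres, the reflection in a hyperplane. For $c>0$, let $\mathbb{L}^{n}$ denote $n$-dimensional Minkowski space, of signature $(+,\dots,+,-)$, let $\mathbb{H}^m(-c)\subset\mathbb{L}^{m+1}$ be the sheet $\{X:\langle X,X\rangle=-1/c,\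 x_{m+1}>0\}$, and let $\mathbb{S}^{k}(c)=\{Y\in\mathbb{R}^{k+1}:\langle Y,Y\rangle=1/c\}$. Let $1\le m\le N-1$, let $\mathbb{L}^{N+2}=V\oplus W$ be an orthogonal decomposition with $V$ time-like, and let $C\colon\mathbb{L}^{m+1}\to V$ and $D\colon\mathbb{R}^{N-m+1}\to W$ be linear isometries. Let $p_0,w\in\mathbb{L}^{N+2}$ be light-like with $\langle p_0,w\rangle=1$, let $A\colon\mathbb{R}^N\to\mathrm{span}\{p_0,w\}^\perp$ be a linear isometry, and let $\Psi(x)=p_0+A(x)-\tfrac12\|x\|^2w$, an isometry of $\mathbb{R}^N$ onto $\{q:\langle q,q\rangle=0,\ \langle q,w\rangle=1\}$. These data define the conformal diffeomorphism $\Theta\colon\mathbb{H}^m(-c)\times\mathbb{S}^{N-m}(c)\to\mathbb{R}^N$ (onto the complement of an $(m-1)$-dimensional sphere) $$\Theta(X,Y)=\Psi^{-1}\!\left(\frac{C(X)+D(Y)}{\langle C(X)+D(Y),w\rangle}\right),$$ which is defined at every point with $C(X)+D(Y)\notin\mathbb{R}w$. Statement. Let $f\colon M^2\to\mathbb{R}^N$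 be a surface (an immersion of a 2-manifold) with flat normal bundle and without umbilic points, and assume that each curvature line, of both families, has constant geodesic curvature in $M^2$ (the constant may depend on the line). Then for every $p\in M^2$ at least one of the following holds: (i) There exist a local isothermic parametrization by curvature lines $\psi\colon J_1\times J_2\to M^2$ of a neighbourhood of $p$, an isometry $\Phi\colon\mathbb{R}^{N_1}\times\mathbb{R}^{N_2}\to\mathbb{R}^N$, unit speed curves $\alpha\colon J_1\to\mathbb{R}^{N_1}$ and $\beta\colon J_2\to\mathbb{R}^{N_2}$, and an inversion $I$ in $\mathbb{R}^N$ whose centre (if it is an inversion in a sphere) does not lie on the image of $\Phi\circ(\alpha\times\beta)$, such that $f\circ\psi=I\circ\Phi\circ(\alpha\times\beta)$. (ii) There exist a local isothermic parametrization by curvature lines $\psi\colon J_1\times J_2\to M^2$ of a neighbourhood of $p$, numbers $c>0$ and $1\le m\le N-1$, unit speed curves $\alpha\colon J_1\to\mathbb{H}^{m}(-c)$ and $\beta\colon J_2\to\mathbb{S}^{N-m}(c)$, and a conformal diffeomorphism $\Theta$ as above, defined on the image of $\alpha\times\beta$, such that $f\circ\psi=\Theta\circ(\alpha\times\beta)$.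 -/

import Mathlib

open scoped Manifold ContDiff

namespace Isothermic

noncomputable section

/-- Euclidean space `ℝ^n`. -/
abbrev E (n : ℕ) := EuclideanSpace ℝ (Fin n)

/-! ### Geometry of an immersed surface `f : M² → ℝ^N` -/

section Patch

variable {N : ℕ}

/-- Orthogonal projection of `ℝ^N` onto the tangent plane of the patch `F` at `x`. -/
def tangentProj (F : E 2 → E N) (x : E 2) (v : E N) : E N :=
  (LinearMap.range (fderiv ℝ F x).toLinearMap).starProjection v

/-- Orthogonal projection of `ℝ^N` onto the normal space of the patch `F` at `x`. -/
def normalProj (F : E 2 → E N) (x : E 2) (v : E N) : E N :=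
  (LinearMap.range (fderiv ℝ F x).toLinearMap)ᗮ.starProjection v

/-- `ξ` is a smooth normal vector field of the patch `F` on the open set `V`. -/
def IsNormalField (F : E 2 → E N) (V : Set (E 2)) (ξ : E 2 → E N) : Prop :=
  ContDiffOn ℝ ∞ ξ V ∧ ∀ x ∈ V, ∀ u : E 2, inner ℝ (fderiv ℝ F x u) (ξ x) = 0

/-- The normal connection: `∇^⊥_u ξ` for the constant coordinate field `u`. -/
def normalDeriv (F : E 2 → E N) (ξ : E 2 → E N) (u : E 2) (x : E 2) : E N :=
  normalProj F x (fderiv ℝ ξ x u)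

/-- The curvature of the normal connection of the patch `F` vanishes on `U`:
`∇^⊥_u ∇^⊥_v ξ = ∇^⊥_v ∇^⊥_u ξ` for (commuting) constant coordinate fields `u`, `v` and all local
normal fields `ξ`. -/
def PatchFlatNormal (F : E 2 → E N) (U : Set (E 2)) : Prop :=
  ∀ V ⊆ U, IsOpen V → ∀ ξ : E 2 → E N, IsNormalField F V ξ → ∀ u v : E 2, ∀ x ∈ V,
    normalDeriv F (normalDeriv F ξ v) u x = normalDeriv F (normalDeriv F ξ u) v x

end Patch

section Surface

variable {N : ℕ} {M : Type*} [TopologicalSpace M] [ChartedSpace (E 2) M]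

/-- The expression of `f` in the preferred chart at `p`. -/
def localRep (f : M → E N) (p : M) : E 2 → E N := f ∘ (extChartAt (𝓡 2) p).symm

/-- The differential of `f` at `p`. -/
def diff (f : M → E N) (p : M) : TangentSpace (𝓡 2) p →L[ℝ] E N :=
  mfderiv (𝓡 2) 𝓘(ℝ, E N) f p

/-- `f` is a smooth immersion. -/
def IsSmoothImmersion (f : M → E N) : Prop :=
  ContMDiff (𝓡 2) 𝓘(ℝ, E N) ∞ f ∧ ∀ p, Function.Injective (diff f p)

/-- The metric induced by `f`. -/
def metric (f : M → E N) (p : M) (X Y : TangentSpace (𝓡 2) p) : ℝ :=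
  inner ℝ (diff f p X) (diff f p Y)

/-- The second fundamental form of `f` at `p`: the normal component of the second derivative of `f`
in the chart at `p`, the chart through which Mathlib identifies `T_p M` with `ℝ²`. -/
def sff (f : M → E N) (p : M) (X Y : TangentSpace (𝓡 2) p) : E N :=
  normalProj (localRep f p) (extChartAt (𝓡 2) p p)
    (fderiv ℝ (fderiv ℝ (localRep f p)) (extChartAt (𝓡 2) p p) X Y)

/-- The normal bundle of `f` is flat. -/
def HasFlatNormalBundle (f : M → E N) : Prop :=
  ∀ p : M, PatchFlatNormal (localRep f p) (extChartAt (𝓡 2) p).target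

/-- `p` is an umbilic point of `f`. -/
def IsUmbilic (f : M → E N) (p : M) : Prop :=
  ∃ H : E N, ∀ X Y : TangentSpace (𝓡 2) p, sff f p X Y = metric f p X Y • H

/-- `X` is a principal direction of `f` at `p`: an eigenvector of all shape operators `A_ξ`, where
`⟨A_ξ X, Y⟩ = ⟨α(X, Y), ξ⟩`. -/
def IsPrincipal (f : M → E N) (p : M) (X : TangentSpace (𝓡 2) p) : Prop :=
  X ≠ 0 ∧ ∀ ξ : E N, (∀ Z, inner ℝ (diff f p Z) ξ = 0) →
    ∃ l : ℝ, ∀ Y, inner ℝ (sff f p X Y) ξ = l * metric f p X Y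

/-- The velocity of a curve in `M`. -/
def velocity (γ : ℝ → M) (t : ℝ) : TangentSpace (𝓡 2) (γ t) :=
  mfderiv 𝓘(ℝ, ℝ) (𝓡 2) γ t (1 : ℝ)

/-- `γ`, on the open interval `J`, is a curvature line of `f` parametrized by arc length. -/
def IsCurvatureLine (f : M → E N) (γ : ℝ → M) (J : Set ℝ) : Prop :=
  IsOpen J ∧ J.OrdConnected ∧ ContMDiffOn 𝓘(ℝ, ℝ) (𝓡 2) ∞ γ J ∧
    ∀ t ∈ J, ‖diff f (γ t) (velocity γ t)‖ = 1 ∧ IsPrincipal f (γ t) (velocity γ t)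

/-- The (absolute) geodesic curvature of a curve `γ` of unit speed: the length of
`∇_{γ'} γ'`, whose image under `df` is the tangential part of `(f ∘ γ)''`. On an interval this is
constant if and only if the signed geodesic curvature is, the latter being continuous. -/
def geodesicCurvature (f : M → E N) (γ : ℝ → M) (t : ℝ) : ℝ :=
  ‖tangentProj (localRep f (γ t)) (extChartAt (𝓡 2) (γ t) (γ t)) (deriv (deriv (f ∘ γ)) t)‖

/-- The curvature lines of `f`, of both families, have constant geodesic curvature (the constant may
vary from line to line). -/
def CurvatureLinesHaveConstantGeodesicCurvature (f : M → E N) : Prop :=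
  ∀ (γ : ℝ → M) (J : Set ℝ), IsCurvatureLine f γ J →
    ∀ s ∈ J, ∀ t ∈ J, geodesicCurvature f γ s = geodesicCurvature f γ t

/-- The coordinate vectors `∂_s` and `∂_t` of a parametrization of (a part of) `M`. -/
def coordVec (ψ : ℝ × ℝ → M) (z : ℝ × ℝ) (e : ℝ × ℝ) : TangentSpace (𝓡 2) (ψ z) :=
  mfderiv 𝓘(ℝ, ℝ × ℝ) (𝓡 2) ψ z e

/-- `ψ` is an isothermic parametrization by curvature lines, with domain the product `J₁ × J₂` of
two open intervals, of an open neighbourhood of `p`: a diffeomorphism onto this neighbourhood,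
conformal for the flat metric `ds² + dt²`, whose coordinate curves are curvature lines. -/
def IsIsothermicAt (f : M → E N) (p : M) (J₁ J₂ : Set ℝ)
    (ψ : PartialDiffeomorph 𝓘(ℝ, ℝ × ℝ) (𝓡 2) (ℝ × ℝ) M ∞) : Prop :=
  IsOpen J₁ ∧ J₁.OrdConnected ∧ IsOpen J₂ ∧ J₂.OrdConnected ∧
    ψ.source = J₁ ×ˢ J₂ ∧ p ∈ ψ.target ∧
    ∀ z ∈ J₁ ×ˢ J₂,
      (∃ φ : ℝ, 0 < φ ∧
        metric f (ψ z) (coordVec ψ z (1, 0)) (coordVec ψ z (1, 0)) = φ ^ 2 ∧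
        metric f (ψ z) (coordVec ψ z (0, 1)) (coordVec ψ z (0, 1)) = φ ^ 2 ∧
        metric f (ψ z) (coordVec ψ z (1, 0)) (coordVec ψ z (0, 1)) = 0) ∧
      IsPrincipal f (ψ z) (coordVec ψ z (1, 0)) ∧ IsPrincipal f (ψ z) (coordVec ψ z (0, 1))

end Surface

/-! ### Curves, inversions -/

/-- `α` is a smooth curve of unit speed in `ℝ^n` on the open interval `J`. -/
def IsUnitSpeed {n : ℕ} (α : ℝ → E n) (J : Set ℝ) : Prop :=
  ContDiffOn ℝ ∞ α J ∧ ∀ s ∈ J, ‖deriv α s‖ = 1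

/-- `I` is the inversion in a hypersphere of `ℝ^N` and is defined on `D`, that is, `D` does not
contain the centre. Hyperplanes count as hyperspheres; the inversion in one is the reflection. -/
def IsInversionOn {N : ℕ} (I : E N → E N) (D : Set (E N)) : Prop :=
  (∃ (q : E N) (r : ℝ), 0 < r ∧ q ∉ D ∧ I = EuclideanGeometry.inversion q r) ∨
    ∃ q v : E N, ‖v‖ = 1 ∧ I = fun x => x - (2 * inner ℝ v (x - q)) • v

/-! ### The light cone model and the conformal diffeomorphisms `ℍ^m(-c) × 𝕊^k(c) → ℝ^(m+k)` -/

/-- Minkowski space `𝕃^(n+1)` of dimension `n + 1`. -/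
abbrev L (n : ℕ) := E n × ℝ

/-- The Lorentz scalar product, of signature `(+, …, +, -)`. -/
def lor {n : ℕ} (X Y : L n) : ℝ := inner ℝ X.1 Y.1 - X.2 * Y.2

/-- Hyperbolic space `ℍ^m(-c)` (for `m = 1`, a branch of a hyperbola) in `𝕃^(m+1)`. -/
def hyp (m : ℕ) (c : ℝ) : Set (L m) := {X | lor X X = -1 / c ∧ 0 < X.2}

/-- The sphere `𝕊^k(c)` in `ℝ^(k+1)`. -/
def sph (k : ℕ) (c : ℝ) : Set (E (k + 1)) := {Y | inner ℝ Y Y = 1 / c}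

/-- `α` is a smooth curve of unit speed in `ℍ^m(-c)` on the open interval `J`. -/
def IsUnitSpeedHyp {m : ℕ} (c : ℝ) (α : ℝ → L m) (J : Set ℝ) : Prop :=
  ContDiffOn ℝ ∞ α J ∧ ∀ s ∈ J, α s ∈ hyp m c ∧ lor (deriv α s) (deriv α s) = 1

/-- `β` is a smooth curve of unit speed in `𝕊^k(c)` on the open interval `J`. -/
def IsUnitSpeedSph {k : ℕ} (c : ℝ) (β : ℝ → E (k + 1)) (J : Set ℝ) : Prop :=
  IsUnitSpeed β J ∧ ∀ t ∈ J, β t ∈ sph k c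

/-- A triple `(p₀, w, A)` that represents `ℝ^N` as the section `⟨p, w⟩ = 1` of the light cone of
`𝕃^(N+2)`: `w`, `p₀` are light-like with `⟨p₀, w⟩ = 1`, and `A` is a linear isometry of `ℝ^N` onto
`span {p₀, w}^⊥`. -/
structure Triple (N : ℕ) where
  p₀ : L (N + 1)
  w : L (N + 1)
  A : E N →ₗ[ℝ] L (N + 1)
  lor_p₀ : lor p₀ p₀ = 0
  lor_w : lor w w = 0
  lor_p₀_w : lor p₀ w = 1
  lor_A : ∀ x y, lor (A x) (A y) = inner ℝ x y
  lor_A_p₀ : ∀ x, lor (A x) p₀ = 0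
  lor_A_w : ∀ x, lor (A x) w = 0

/-- The isometry `Ψ` of `ℝ^N` onto `{p | ⟨p, p⟩ = 0, ⟨p, w⟩ = 1}`. -/
def Triple.Psi {N : ℕ} (T : Triple N) (x : E N) : L (N + 1) :=
  T.p₀ + T.A x - ((1 / 2 : ℝ) * ‖x‖ ^ 2) • T.w

/-- The projection `q ↦ Ψ⁻¹ (q / ⟨q, w⟩)` of the light cone onto `ℝ^N`, meaningful for light-like
`q` with `⟨q, w⟩ ≠ 0`, that is, for `q` outside the line of `w`. -/
def Triple.toEuclidean {N : ℕ} (T : Triple N) (q : L (N + 1)) : E N :=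
  Function.invFun T.Psi ((lor q T.w)⁻¹ • q)

/-- Linear isometries `C : 𝕃^(m+1) → V` and `D : ℝ^(k+1) → W`, where `𝕃^(N+2) = V ⊕ W` is an
orthogonal decomposition with `V` time-like and `N = m + k`. -/
structure Splitting (m k N : ℕ) where
  dim : m + k = N
  C : L m →ₗ[ℝ] L (N + 1)
  D : E (k + 1) →ₗ[ℝ] L (N + 1)
  lor_C : ∀ X X', lor (C X) (C X') = lor X X'
  lor_D : ∀ Y Y', lor (D Y) (D Y') = inner ℝ Y Y'
  lor_C_D : ∀ X Y, lor (C X) (D Y) = 0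

/-- The map `(X, Y) ↦ C X + D Y`, which takes `ℍ^m(-c) × 𝕊^k(c)` isometrically into the light
cone. -/
def Splitting.toCone {m k N : ℕ} (S : Splitting m k N) (z : L m × E (k + 1)) : L (N + 1) :=
  S.C z.1 + S.D z.2

/-- The conformal diffeomorphism `Θ : ℍ^m(-c) × 𝕊^k(c) → ℝ^N` onto the complement of an
`(m-1)`-dimensional sphere. It is defined where `C X + D Y` is not a multiple of `w`. -/
def Theta {m k N : ℕ} (T : Triple N) (S : Splitting m k N) (z : L m × E (k + 1)) : E N :=
  T.toEuclidean (S.toCone z)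

/-! ### The two cases -/

section Cases

variable {N : ℕ} {M : Type*} [TopologicalSpace M] [ChartedSpace (E 2) M]

/-- Near `p`, in isothermic curvature line coordinates, `f` is `I ∘ Φ ∘ (α × β)` with `I` an
inversion, `Φ : ℝ^N₁ × ℝ^N₂ → ℝ^N` an isometry and `α`, `β` curves of unit speed. -/
def IsInvertedProductAt (f : M → E N) (p : M) : Prop :=
  ∃ (J₁ J₂ : Set ℝ) (ψ : PartialDiffeomorph 𝓘(ℝ, ℝ × ℝ) (𝓡 2) (ℝ × ℝ) M ∞),
    IsIsothermicAt f p J₁ J₂ ψ ∧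
    ∃ (N₁ N₂ : ℕ) (Φ : WithLp 2 (E N₁ × E N₂) ≃ᵢ E N) (I : E N → E N)
      (α : ℝ → E N₁) (β : ℝ → E N₂),
      IsUnitSpeed α J₁ ∧ IsUnitSpeed β J₂ ∧
      IsInversionOn I {x | ∃ s ∈ J₁, ∃ t ∈ J₂, x = Φ (WithLp.toLp 2 (α s, β t))} ∧
      ∀ s ∈ J₁, ∀ t ∈ J₂, f (ψ (s, t)) = I (Φ (WithLp.toLp 2 (α s, β t)))

/-- Near `p`, in isothermic curvature line coordinates, `f` is `Θ ∘ (α × β)` with `α` and `β` curves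
of unit speed in `ℍ^m(-c)` and `𝕊^(N-m)(c)`. -/
def IsHypSphProductAt (f : M → E N) (p : M) : Prop :=
  ∃ (J₁ J₂ : Set ℝ) (ψ : PartialDiffeomorph 𝓘(ℝ, ℝ × ℝ) (𝓡 2) (ℝ × ℝ) M ∞),
    IsIsothermicAt f p J₁ J₂ ψ ∧
    ∃ (m k : ℕ) (c : ℝ) (T : Triple N) (S : Splitting m k N) (α : ℝ → L m) (β : ℝ → E (k + 1)),
      1 ≤ m ∧ 1 ≤ k ∧ 0 < c ∧
      IsUnitSpeedHyp c α J₁ ∧ IsUnitSpeedSph c β J₂ ∧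
      ∀ s ∈ J₁, ∀ t ∈ J₂, lor (S.toCone (α s, β t)) T.w ≠ 0 ∧
        f (ψ (s, t)) = Theta T S (α s, β t)

end Cases

end

end Isothermic

/-!
Flatness of the normal bundle makes the second fundamental forms `⟨α, η⟩` commute, so near a point
that is not umbilic there is a smooth orthonormal frame `X`, `Y` of principal directions. Let
`ω₁`, `ω₂` be the dual frame and `κ_X`, `κ_Y` the geodesic curvatures of the integral curves. Since
`κ_X` and `κ_Y` are constant along the curves of their own family, `κ_Y ω₁ + κ_X ω₂` is closed;
for a primitive `log ρ` the forms `ρ ω₁` and `ρ ω₂` are closed, and they give isothermic coordinates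
with conformal factor `1 / ρ`.

The lift `ρ Ψ(f)` of `f` to the light cone of `𝕃^(N+2)` is then isometric and has vanishing mixed
derivative: it is `p(s) + q(t)`, where the differences of values of `p` are orthogonal to those of
`q`. If one of the two spans of these differences is space-like, the lift splits as
`C (α(s)) + D (β(t))`, which is case (ii). Otherwise both spans contain a causal vector; these two,
being orthogonal, are multiples of one light-like `ν`, and `⟨ρ Ψ(f), ν⟩` is constant. If `ν` is a
multiple of `w`, then `ρ` is constant and `f` itself is a product of curves; if not, `ν`
represents a point of `ℝ^N`, and an inversion centred at it makes `f` a product of curves.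
-/

namespace Isothermic

noncomputable section

open Set Filter Topology

local notation:max "D²" F:max => fderiv ℝ (fderiv ℝ F)

/-! ### Analytic preliminaries -/

section Analysis

variable {G H : Type*} [NormedAddCommGroup G] [NormedSpace ℝ G] [NormedAddCommGroup H]
  [NormedSpace ℝ H]

theorem differentiableAt_of_contDiffOn {a : G → H} {V : Set G} (ha : ContDiffOn ℝ ∞ a V)
    (hV : IsOpen V) {x : G} (hx : x ∈ V) : DifferentiableAt ℝ a x :=
  (ha.contDiffAt (hV.mem_nhds hx)).differentiableAt (by simp)

theorem contDiffOn_fderiv {a : G → H} {V : Set G} (ha : ContDiffOn ℝ ∞ a V) (hV : IsOpen V) :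
    ContDiffOn ℝ ∞ (fderiv ℝ a) V :=
  ha.fderiv_of_isOpen hV (by simp)

theorem fderiv_fderiv_symm {a : G → H} {V : Set G} (ha : ContDiffOn ℝ ∞ a V) (hV : IsOpen V)
    {x : G} (hx : x ∈ V) (u v : G) : D² a x u v = D² a x v u :=
  ((ha.contDiffAt (hV.mem_nhds hx)).isSymmSndFDerivAt
    (minSmoothness_of_isRCLikeNormedField.trans_le ENat.LEInfty.out)) u v

theorem fderiv_fderiv_apply {a : G → H} {V : Set G} (ha : ContDiffOn ℝ ∞ a V) (hV : IsOpen V)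
    {x : G} (hx : x ∈ V) (u v : G) : fderiv ℝ (fun y => fderiv ℝ a y v) x u = D² a x u v := by
  rw [fderiv_clm_apply (differentiableAt_of_contDiffOn (contDiffOn_fderiv ha hV) hV hx)
    (differentiableAt_const v)]
  simp

theorem inner_fderiv_of_inner_const {E : Type*} [NormedAddCommGroup E] [InnerProductSpace ℝ E]
    {a b : G → E} {V : Set G} (hV : IsOpen V) (ha : ContDiffOn ℝ ∞ a V) (hb : ContDiffOn ℝ ∞ b V)
    {r : ℝ} (hab : ∀ x ∈ V, inner ℝ (a x) (b x) = r) {x : G} (hx : x ∈ V) (v : G) :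
    inner ℝ (fderiv ℝ a x v) (b x) = -inner ℝ (a x) (fderiv ℝ b x v) := by
  have hconst : (fun y => inner ℝ (a y) (b y)) =ᶠ[𝓝 x] fun _ => r :=
    (hV.eventually_mem hx).mono hab
  have hderiv := fderiv_inner_apply ℝ (differentiableAt_of_contDiffOn ha hV hx)
    (differentiableAt_of_contDiffOn hb hV hx) v
  rw [hconst.fderiv_eq, fderiv_fun_const] at hderiv
  exact eq_neg_of_add_eq_zero_right hderiv.symm

theorem exists_primitive {E : Type*} [NormedAddCommGroup E] [InnerProductSpace ℝ E] {F W : G → E}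
    {V : Set G} (hV : IsOpen V) (hconv : Convex ℝ V) (hF : ContDiffOn ℝ ∞ F V)
    (hW : ContDiffOn ℝ ∞ W V) (hsymm : ∀ x ∈ V, ∀ u v,
      inner ℝ (fderiv ℝ W x u) (fderiv ℝ F x v) = inner ℝ (fderiv ℝ W x v) (fderiv ℝ F x u)) :
    ∃ g : G → ℝ, ContDiffOn ℝ ∞ g V ∧
      ∀ x ∈ V, ∀ v, fderiv ℝ g x v = inner ℝ (W x) (fderiv ℝ F x v) := by
  let η : G → G →L[ℝ] ℝ := fun x => (innerSL ℝ (W x)).comp (fderiv ℝ F x)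
  have sη : ContDiffOn ℝ ∞ η V :=
    ((innerSL ℝ).contDiff.comp_contDiffOn hW).clm_comp (contDiffOn_fderiv hF hV)
  have hη (x) (hx : x ∈ V) (u v : G) : fderiv ℝ η x u v
      = inner ℝ (W x) (D² F x u v) + inner ℝ (fderiv ℝ W x u) (fderiv ℝ F x v) := by
    have hdF := differentiableAt_of_contDiffOn
      ((contDiffOn_fderiv hF hV).clm_apply (contDiffOn_const (c := v))) hV hx
    rw [← fderiv_fderiv_apply hF hV hx, ← fderiv_inner_apply ℝ
      (differentiableAt_of_contDiffOn hW hV hx) hdF u]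
    have hcoe : fderiv ℝ (fun y => η y v) x u = fderiv ℝ η x u v := by
      rw [fderiv_clm_apply (differentiableAt_of_contDiffOn sη hV hx) (differentiableAt_const v)]
      simp
    exact hcoe.symm
  obtain ⟨g, hg⟩ := hconv.exists_forall_hasFDerivAt_of_fderiv_symmetric hV
    (sη.differentiableOn (by simp)) fun x hx u v => by
      rw [hη x hx, hη x hx, hsymm x hx, fderiv_fderiv_symm hF hV hx]
  refine ⟨g, (contDiffOn_infty_iff_fderiv_of_isOpen hV).2
    ⟨fun x hx => (hg x hx).differentiableAt.differentiableWithinAt,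
      sη.congr fun x hx => (hg x hx).fderiv⟩, fun x hx v => ?_⟩
  rw [(hg x hx).fderiv]
  rfl

theorem contDiffOn_integralCurve {X : G → G} {V : Set G} (hX : ContDiffOn ℝ ∞ X V) {c : ℝ → G}
    {J : Set ℝ} (hJ : IsOpen J) (hcV : ∀ t ∈ J, c t ∈ V)
    (hc : ∀ t ∈ J, HasDerivAt c (X (c t)) t) : ContDiffOn ℝ ∞ c J := by
  rw [contDiffOn_infty]
  intro n
  induction n with
  | zero => exact contDiffOn_zero.2 fun t ht => (hc t ht).continuousAt.continuousWithinAt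
  | succ n ih =>
    rw [Nat.cast_succ, contDiffOn_succ_iff_deriv_of_isOpen hJ]
    refine ⟨fun t ht => (hc t ht).differentiableAt.differentiableWithinAt, by simp, ?_⟩
    exact ((hX.of_le (by exact_mod_cast le_top)).comp ih hcV).congr fun t ht => (hc t ht).deriv

theorem exists_integralCurve [CompleteSpace G] {X : G → G} {V : Set G} (hV : IsOpen V)
    (hX : ContDiffOn ℝ ∞ X V) {x : G} (hx : x ∈ V) :
    ∃ (c : ℝ → G) (J : Set ℝ), IsOpen J ∧ J.OrdConnected ∧ (0 : ℝ) ∈ J ∧ c 0 = x ∧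
      (∀ t ∈ J, c t ∈ V) ∧ ∀ t ∈ J, HasDerivAt c (X (c t)) t := by
  have hX1 : ContDiffAt ℝ 1 X x :=
    (hX.contDiffAt (hV.mem_nhds hx)).of_le (by exact_mod_cast le_top)
  obtain ⟨c, hc0, ε, hε, hc⟩ :=
    hX1.exists_forall_mem_closedBall_exists_eq_forall_mem_Ioo_hasDerivAt₀ 0
  have h0 : (0 : ℝ) ∈ Ioo (0 - ε) (0 + ε) := by constructor <;> linarith
  have hcV : c ⁻¹' V ∈ 𝓝 (0 : ℝ) :=
    (hc 0 h0).continuousAt.preimage_mem_nhds (hc0 ▸ hV.mem_nhds hx)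
  obtain ⟨δ, hδ, hball⟩ := Metric.mem_nhds_iff.1 (inter_mem hcV (Ioo_mem_nhds h0.1 h0.2))
  exact ⟨c, Metric.ball 0 δ, Metric.isOpen_ball, (convex_ball (0 : ℝ) δ).ordConnected,
    Metric.mem_ball_self hδ, hc0, fun t ht => (hball ht).1, fun t ht => hc t (hball ht).2⟩

theorem deriv_eq_zero_of_abs_eq {k : ℝ → ℝ} {k' t : ℝ} (hk : HasDerivAt k k' t)
    (habs : ∀ᶠ s in 𝓝 t, |k s| = |k t|) : k' = 0 := by
  rcases le_total 0 (k t) with h | h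
  · have hmax : IsLocalMax k t := habs.mono fun s hs =>
      (le_abs_self _).trans (hs.trans (abs_of_nonneg h)).le
    exact hmax.hasDerivAt_eq_zero hk
  · have hmin : IsLocalMin k t := habs.mono fun s hs => by
      linarith [neg_abs_le (k s), abs_of_nonpos h]
    exact hmin.hasDerivAt_eq_zero hk

theorem fderiv_eq_zero_of_abs_const [CompleteSpace G] {X : G → G} {V : Set G} (hV : IsOpen V)
    (hX : ContDiffOn ℝ ∞ X V) {k : G → ℝ} (hk : DifferentiableOn ℝ k V)
    (h : ∀ (c : ℝ → G) (J : Set ℝ), IsOpen J → J.OrdConnected → (∀ t ∈ J, c t ∈ V) →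
      (∀ t ∈ J, HasDerivAt c (X (c t)) t) → ∀ s ∈ J, ∀ t ∈ J, |k (c s)| = |k (c t)|)
    {x : G} (hx : x ∈ V) : fderiv ℝ k x (X x) = 0 := by
  obtain ⟨c, J, hJ, hJc, h0, rfl, hcV, hc⟩ := exists_integralCurve hV hX hx
  have hd := (hk.differentiableAt (hV.mem_nhds hx)).hasFDerivAt.comp_hasDerivAt 0 (hc 0 h0)
  exact deriv_eq_zero_of_abs_eq hd
    ((hJ.eventually_mem h0).mono fun t ht => h c J hJ hJc hcV hc t ht 0 h0)

theorem exists_contDiffOn_arg {z : G → ℂ} {U : Set G} (hU : IsOpen U) (hz : ContDiffOn ℝ ∞ z U)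
    {x₀ : G} (hx₀ : x₀ ∈ U) (h0 : z x₀ ≠ 0) :
    ∃ V ⊆ U, IsOpen V ∧ x₀ ∈ V ∧ ∃ θ : G → ℝ, ContDiffOn ℝ ∞ θ V ∧
      ∀ x ∈ V, z x ≠ 0 ∧ z x = ‖z x‖ * Complex.exp (θ x * Complex.I) := by
  have hq : ContDiffOn ℝ ∞ (fun x => z x / z x₀) U := hz.div_const _
  refine ⟨U ∩ (fun x => z x / z x₀) ⁻¹' Complex.slitPlane, inter_subset_left,
    hq.continuousOn.isOpen_inter_preimage hU Complex.isOpen_slitPlane,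
    ⟨hx₀, by simp [h0]⟩, fun x => (Complex.log (z x / z x₀)).im + (z x₀).arg, ?_, ?_⟩
  · refine ContDiffOn.add ?_ contDiffOn_const
    exact Complex.imCLM.contDiff.comp_contDiffOn fun x hx =>
      ((Complex.contDiffAt_log hx.2).restrict_scalars ℝ).comp_contDiffWithinAt x
        (hq.mono inter_subset_left x hx)
  · rintro x ⟨-, hx⟩
    refine ⟨fun h => Complex.slitPlane_ne_zero hx (by simp [h]), ?_⟩
    calc z x = z x / z x₀ * z x₀ := (div_mul_cancel₀ _ h0).symm
      _ = (‖z x / z x₀‖ * Complex.exp ((z x / z x₀).arg * Complex.I))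
            * (‖z x₀‖ * Complex.exp ((z x₀).arg * Complex.I)) := by
          simp only [Complex.norm_mul_exp_arg_mul_I]
      _ = _ := by
          have hn : (‖z x₀‖ : ℂ) ≠ 0 := by simpa using h0
          simp only [Complex.log_im]
          rw [Complex.ofReal_add, add_mul, Complex.exp_add, norm_div,
            Complex.ofReal_div]
          field_simp

end Analysis

/-! ### Orthonormal and principal frames -/

section Projections

variable {N : ℕ} {F : E 2 → E N} {x : E 2}

theorem inner_fderiv_normalProj (F : E 2 → E N) (x u : E 2) (v : E N) :
    inner ℝ (fderiv ℝ F x u) (normalProj F x v) = 0 :=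
  (Submodule.mem_orthogonal _ _).1 (Submodule.starProjection_apply_mem _ v) _ ⟨u, rfl⟩

theorem normalProj_of_normal {η : E N} (hη : ∀ u, inner ℝ (fderiv ℝ F x u) η = 0) :
    normalProj F x η = η :=
  Submodule.starProjection_eq_self_iff.2 ((Submodule.mem_orthogonal _ _).2 (by
    rintro _ ⟨u, rfl⟩; exact hη u))

theorem inner_normalProj {η : E N} (hη : ∀ u, inner ℝ (fderiv ℝ F x u) η = 0) (v : E N) :
    inner ℝ (normalProj F x v) η = inner ℝ v η := by
  nth_rw 2 [← normalProj_of_normal hη]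
  exact Submodule.inner_starProjection_left_eq_right _ _ _

theorem normalProj_eq_zero {v : E N}
    (hv : ∀ η : E N, (∀ u, inner ℝ (fderiv ℝ F x u) η = 0) → inner ℝ η v = 0) :
    normalProj F x v = 0 := by
  have hn := fun u => inner_fderiv_normalProj F x u v
  rw [← inner_self_eq_zero (𝕜 := ℝ), inner_normalProj hn, real_inner_comm, hv _ hn]

end Projections

section Frames

variable {N : ℕ} {F : E 2 → E N} {U V : Set (E 2)} {X Y : E 2 → E 2} {x : E 2}

/-- The image `dF(X)` of a vector field `X` under the differential of the patch `F`. -/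
def push (F : E 2 → E N) (X : E 2 → E 2) (x : E 2) : E N := fderiv ℝ F x (X x)

theorem push_smul (φ : E 2 → ℝ) : push F (fun y => φ y • X y) x = φ x • push F X x :=
  map_smul _ _ _

theorem contDiffOn_push (hF : ContDiffOn ℝ ∞ F V) (hV : IsOpen V) (hX : ContDiffOn ℝ ∞ X V) :
    ContDiffOn ℝ ∞ (push F X) V :=
  (contDiffOn_fderiv hF hV).clm_apply hX

theorem fderiv_push (hF : ContDiffOn ℝ ∞ F V) (hV : IsOpen V) (hX : ContDiffOn ℝ ∞ X V)
    (hx : x ∈ V) (v : E 2) :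
    fderiv ℝ (push F X) x v = D² F x v (X x) + fderiv ℝ F x (fderiv ℝ X x v) := by
  change fderiv ℝ (fun y => fderiv ℝ F y (X y)) x v = _
  rw [fderiv_clm_apply (differentiableAt_of_contDiffOn (contDiffOn_fderiv hF hV) hV hx)
    (differentiableAt_of_contDiffOn hX hV hx)]
  simp [add_comm]

theorem inner_fderiv_normalField (hF : ContDiffOn ℝ ∞ F V) (hV : IsOpen V) {ξ : E 2 → E N}
    (hξ : IsNormalField F V ξ) (hx : x ∈ V) (v w : E 2) :
    inner ℝ (fderiv ℝ ξ x v) (fderiv ℝ F x w) = -inner ℝ (ξ x) (D² F x v w) := by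
  rw [inner_fderiv_of_inner_const hV hξ.1 ((contDiffOn_fderiv hF hV).clm_apply contDiffOn_const)
    (fun y hy => (real_inner_comm _ _).trans (hξ.2 y hy w)) hx, fderiv_fderiv_apply hF hV hx]

/-- `X`, `Y` are smooth vector fields on the open set `V`, orthonormal for the metric induced by the
smooth map `F`. -/
structure IsFrame (F : E 2 → E N) (V : Set (E 2)) (X Y : E 2 → E 2) : Prop where
  isOpen : IsOpen V
  smooth : ContDiffOn ℝ ∞ F V
  smooth_fst : ContDiffOn ℝ ∞ X V
  smooth_snd : ContDiffOn ℝ ∞ Y V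
  inner_fst : ∀ x ∈ V, inner ℝ (push F X x) (push F X x) = 1
  inner_snd : ∀ x ∈ V, inner ℝ (push F Y x) (push F Y x) = 1
  inner_fst_snd : ∀ x ∈ V, inner ℝ (push F X x) (push F Y x) = 0

namespace IsFrame

theorem mono (h : IsFrame F U X Y) (hV : IsOpen V) (hVU : V ⊆ U) : IsFrame F V X Y where
  isOpen := hV
  smooth := h.smooth.mono hVU
  smooth_fst := h.smooth_fst.mono hVU
  smooth_snd := h.smooth_snd.mono hVU
  inner_fst x hx := h.inner_fst x (hVU hx)
  inner_snd x hx := h.inner_snd x (hVU hx)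
  inner_fst_snd x hx := h.inner_fst_snd x (hVU hx)

theorem inner_snd_fst (h : IsFrame F V X Y) (hx : x ∈ V) :
    inner ℝ (push F Y x) (push F X x) = 0 := by
  rw [real_inner_comm, h.inner_fst_snd x hx]

theorem swap (h : IsFrame F V X Y) : IsFrame F V Y X where
  isOpen := h.isOpen
  smooth := h.smooth
  smooth_fst := h.smooth_snd
  smooth_snd := h.smooth_fst
  inner_fst := h.inner_snd
  inner_snd := h.inner_fst
  inner_fst_snd _ hx := h.inner_snd_fst hx

theorem decomp (h : IsFrame F V X Y) (hx : x ∈ V) (v : E 2) :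
    v = inner ℝ (fderiv ℝ F x v) (push F X x) • X x
      + inner ℝ (fderiv ℝ F x v) (push F Y x) • Y x := by
  have hli : LinearIndependent ℝ ![X x, Y x] := LinearIndependent.pair_iff.2 fun s t hst => by
    have hpush : s • push F X x + t • push F Y x = 0 := by
      simpa [push] using congrArg (fderiv ℝ F x) hst
    have hs := congrArg (inner ℝ · (push F X x)) hpush
    have ht := congrArg (inner ℝ · (push F Y x)) hpush
    simp only [inner_add_left, real_inner_smul_left, h.inner_fst x hx, h.inner_snd x hx,
      h.inner_fst_snd x hx, h.inner_snd_fst hx, inner_zero_left, mul_one, mul_zero, add_zero,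
      zero_add] at hs ht
    exact ⟨hs, ht⟩
  have hv : v ∈ Submodule.span ℝ {X x, Y x} := by
    rw [← Matrix.range_cons_cons_empty, hli.span_eq_top_of_card_eq_finrank (by simp)]
    trivial
  obtain ⟨a, b, rfl⟩ := Submodule.mem_span_pair.1 hv
  have hpush : fderiv ℝ F x (a • X x + b • Y x) = a • push F X x + b • push F Y x := by
    simp [push]
  simp only [hpush, inner_add_left, real_inner_smul_left, h.inner_fst x hx, h.inner_snd x hx,
    h.inner_fst_snd x hx, h.inner_snd_fst hx, mul_one, mul_zero, zero_add, add_zero]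

theorem fderiv_decomp (h : IsFrame F V X Y) (hx : x ∈ V) (v : E 2) :
    fderiv ℝ F x v = inner ℝ (fderiv ℝ F x v) (push F X x) • push F X x
      + inner ℝ (fderiv ℝ F x v) (push F Y x) • push F Y x := by
  conv_lhs => rw [h.decomp hx v]
  simp [push]

theorem tangentProj_eq (h : IsFrame F V X Y) (hx : x ∈ V) (v : E N) :
    tangentProj F x v = inner ℝ v (push F X x) • push F X x
      + inner ℝ v (push F Y x) • push F Y x := by
  refine Submodule.eq_starProjection_of_mem_of_inner_eq_zero
    (add_mem (Submodule.smul_mem _ _ ⟨X x, rfl⟩) (Submodule.smul_mem _ _ ⟨Y x, rfl⟩)) ?_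
  rintro _ ⟨w, rfl⟩
  change inner ℝ _ (fderiv ℝ F x w) = 0
  rw [h.fderiv_decomp hx w]
  simp only [inner_sub_left, inner_add_left, inner_add_right, real_inner_smul_left,
    real_inner_smul_right, h.inner_fst x hx, h.inner_snd x hx, h.inner_fst_snd x hx,
    h.inner_snd_fst hx]
  ring

theorem normalProj_eq (h : IsFrame F V X Y) (hx : x ∈ V) (v : E N) :
    normalProj F x v = v - (inner ℝ v (push F X x) • push F X x
      + inner ℝ v (push F Y x) • push F Y x) := by
  rw [← h.tangentProj_eq hx, normalProj, tangentProj, Submodule.starProjection_orthogonal_val]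

theorem contDiffOn_push_fst (h : IsFrame F V X Y) : ContDiffOn ℝ ∞ (push F X) V :=
  contDiffOn_push h.smooth h.isOpen h.smooth_fst

theorem contDiffOn_push_snd (h : IsFrame F V X Y) : ContDiffOn ℝ ∞ (push F Y) V :=
  contDiffOn_push h.smooth h.isOpen h.smooth_snd

theorem contDiffOn_normalProj (h : IsFrame F V X Y) {v : E 2 → E N} (hv : ContDiffOn ℝ ∞ v V) :
    ContDiffOn ℝ ∞ (fun y => normalProj F y (v y)) V :=
  (hv.sub (((hv.inner ℝ h.contDiffOn_push_fst).smul h.contDiffOn_push_fst).add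
    ((hv.inner ℝ h.contDiffOn_push_snd).smul h.contDiffOn_push_snd))).congr
    fun _ hy => h.normalProj_eq hy _

theorem isNormalField_normalProj (h : IsFrame F V X Y) (ξ : E N) :
    IsNormalField F V fun y => normalProj F y ξ :=
  ⟨h.contDiffOn_normalProj contDiffOn_const, fun _ _ _ => inner_fderiv_normalProj ..⟩

/-- The two products of second fundamental forms come from the tangential part of `∂_v ξ`, which
`normalDeriv` discards. -/
theorem inner_normalDeriv_normalDeriv (h : IsFrame F V X Y) {ξ η : E 2 → E N}
    (hξ : IsNormalField F V ξ) (hη : IsNormalField F V η) (hx : x ∈ V) (u v : E 2) :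
    inner ℝ (normalDeriv F (normalDeriv F ξ v) u x) (η x)
      = inner ℝ (D² ξ x u v) (η x)
        + inner ℝ (ξ x) (D² F x v (X x)) * inner ℝ (η x) (D² F x u (X x))
        + inner ℝ (ξ x) (D² F x v (Y x)) * inner ℝ (η x) (D² F x u (Y x)) := by
  have sξ : ContDiffOn ℝ ∞ (fun y => fderiv ℝ ξ y v) V :=
    (contDiffOn_fderiv hξ.1 h.isOpen).clm_apply contDiffOn_const
  have dξ := differentiableAt_of_contDiffOn sξ h.isOpen hx
  have dn : DifferentiableAt ℝ (normalDeriv F ξ v) x :=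
    differentiableAt_of_contDiffOn (h.contDiffOn_normalProj sξ) h.isOpen hx
  have dη := differentiableAt_of_contDiffOn hη.1 h.isOpen hx
  have hpair : (fun y => inner ℝ (normalDeriv F ξ v y) (η y))
      =ᶠ[𝓝 x] fun y => inner ℝ (fderiv ℝ ξ y v) (η y) := by
    filter_upwards [h.isOpen.mem_nhds hx] with y hy
    exact inner_normalProj (hη.2 y hy) _
  have hderiv := congrArg (· u) (hpair.fderiv_eq (𝕜 := ℝ))
  simp only [fderiv_inner_apply ℝ dn dη, fderiv_inner_apply ℝ dξ dη,
    fderiv_fderiv_apply hξ.1 h.isOpen hx] at hderiv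
  have htan : inner ℝ (normalDeriv F ξ v x) (fderiv ℝ η x u)
      = inner ℝ (fderiv ℝ ξ x v) (fderiv ℝ η x u)
        - inner ℝ (ξ x) (D² F x v (X x)) * inner ℝ (η x) (D² F x u (X x))
        - inner ℝ (ξ x) (D² F x v (Y x)) * inner ℝ (η x) (D² F x u (Y x)) := by
    have hη' := fun w => inner_fderiv_normalField h.smooth h.isOpen hη hx u w
    simp only [real_inner_comm (fderiv ℝ F x _)] at hη'
    rw [normalDeriv, h.normalProj_eq hx]
    simp only [push, inner_sub_left, inner_add_left, real_inner_smul_left,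
      inner_fderiv_normalField h.smooth h.isOpen hξ hx, hη']
    ring
  rw [normalDeriv, inner_normalProj (hη.2 x hx)]
  linarith

theorem ricci (h : IsFrame F V X Y) (hflat : PatchFlatNormal F V) (hx : x ∈ V) {ξ η : E N}
    (hξ : ∀ u, inner ℝ (fderiv ℝ F x u) ξ = 0) (hη : ∀ u, inner ℝ (fderiv ℝ F x u) η = 0) :
    inner ℝ ξ (D² F x (X x) (Y x)) * inner ℝ η (D² F x (X x) (X x) - D² F x (Y x) (Y x))
      = inner ℝ ξ (D² F x (X x) (X x) - D² F x (Y x) (Y x))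
        * inner ℝ η (D² F x (X x) (Y x)) := by
  have nξ := h.isNormalField_normalProj ξ
  have nη := h.isNormalField_normalProj η
  have hcurv := congrArg (inner ℝ · η) (hflat V subset_rfl h.isOpen _ nξ (X x) (Y x) x hx)
  have hexp := h.inner_normalDeriv_normalDeriv nξ nη hx
  simp only [normalProj_of_normal hξ, normalProj_of_normal hη] at hexp
  simp only [hexp, fderiv_fderiv_symm nξ.1 h.isOpen hx (X x) (Y x),
    fderiv_fderiv_symm h.smooth h.isOpen hx (Y x) (X x)] at hcurv
  simp only [inner_sub_right]
  linarith

theorem exists_normal_ne_zero_of_not_umbilic (h : IsFrame F V X Y) (hx : x ∈ V)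
    (hu : ¬∃ H : E N, ∀ u v, normalProj F x (D² F x u v)
      = inner ℝ (fderiv ℝ F x u) (fderiv ℝ F x v) • H) :
    ∃ ξ : E N, (∀ u, inner ℝ (fderiv ℝ F x u) ξ = 0) ∧
      ¬(inner ℝ ξ (D² F x (X x) (X x) - D² F x (Y x) (Y x)) = 0
        ∧ inner ℝ ξ (D² F x (X x) (Y x)) = 0) := by
  by_contra! hcon
  have hXX := normalProj_eq_zero fun η hη => (hcon η hη).1
  have hXY := normalProj_eq_zero fun η hη => (hcon η hη).2
  refine hu ⟨normalProj F x (D² F x (Y x) (Y x)), fun u v => ?_⟩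
  rw [h.fderiv_decomp hx u, h.fderiv_decomp hx v]
  conv_lhs => rw [h.decomp hx u, h.decomp hx v]
  unfold normalProj at hXX hXY ⊢
  rw [map_sub, sub_eq_zero] at hXX
  simp only [map_add, map_smul, add_apply, smul_apply, fderiv_fderiv_symm h.smooth h.isOpen hx
    (Y x) (X x), hXX, hXY, smul_zero, add_zero, zero_add, inner_add_left, inner_add_right,
    real_inner_smul_left, real_inner_smul_right, h.inner_fst x hx, h.inner_snd x hx,
    h.inner_fst_snd x hx, h.inner_snd_fst hx, smul_smul, ← add_smul]
  congr 1
  ring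

theorem rotate (h : IsFrame F V X Y) {θ : E 2 → ℝ} (hθ : ContDiffOn ℝ ∞ θ V) :
    IsFrame F V (fun x => Real.cos (θ x) • X x + Real.sin (θ x) • Y x)
      (fun x => -Real.sin (θ x) • X x + Real.cos (θ x) • Y x) := by
  have sc := Real.contDiff_cos.comp_contDiffOn hθ
  have ss := Real.contDiff_sin.comp_contDiffOn hθ
  have hpush (a b : E 2 → ℝ) (y : E 2) :
      push F (fun x => a x • X x + b x • Y x) y = a y • push F X y + b y • push F Y y := by
    simp [push]
  refine ⟨h.isOpen, h.smooth, (sc.smul h.smooth_fst).add (ss.smul h.smooth_snd),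
    (ss.neg.smul h.smooth_fst).add (sc.smul h.smooth_snd), fun x hx => ?_, fun x hx => ?_,
    fun x hx => ?_⟩
  all_goals
    simp only [hpush, inner_add_left, inner_add_right,
      real_inner_smul_left, real_inner_smul_right, h.inner_fst x hx, h.inner_snd x hx,
      h.inner_fst_snd x hx, h.inner_snd_fst hx]
    linarith [Real.sin_sq_add_cos_sq (θ x)]

end IsFrame

theorem exists_normalizing_factor (hU : IsOpen U) (hF : ContDiffOn ℝ ∞ F U)
    (hinj : ∀ x ∈ U, Function.Injective (fderiv ℝ F x)) {Z : E 2 → E 2}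
    (hZ : ContDiffOn ℝ ∞ Z U) (hZ0 : ∀ x ∈ U, Z x ≠ 0) :
    ∃ φ : E 2 → ℝ, ContDiffOn ℝ ∞ φ U ∧
      ∀ x ∈ U, inner ℝ (push F (fun y => φ y • Z y) x) (push F (fun y => φ y • Z y) x) = 1 := by
  have hne : ∀ x ∈ U, push F Z x ≠ 0 := fun x hx h =>
    hZ0 x hx (hinj x hx (h.trans (map_zero _).symm))
  have hnorm (x) (hx : x ∈ U) : ‖push F Z x‖ ≠ 0 := norm_ne_zero_iff.2 (hne x hx)
  refine ⟨fun x => ‖push F Z x‖⁻¹, ((contDiffOn_push hF hU hZ).norm ℝ hne).inv hnorm,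
    fun x hx => ?_⟩
  rw [push_smul, real_inner_self_eq_norm_sq, norm_smul, norm_inv, norm_norm,
    inv_mul_cancel₀ (hnorm x hx), one_pow]

theorem exists_isFrame (hU : IsOpen U) (hF : ContDiffOn ℝ ∞ F U)
    (hinj : ∀ x ∈ U, Function.Injective (fderiv ℝ F x)) : ∃ X Y, IsFrame F U X Y := by
  let e (i : Fin 2) : E 2 := EuclideanSpace.single i 1
  obtain ⟨φ, hφ, hX⟩ := exists_normalizing_factor hU hF hinj (Z := fun _ => e 0)
    contDiffOn_const fun _ _ h => by simpa [e] using congrArg (fun v : E 2 => v 0) h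
  let X : E 2 → E 2 := fun x => φ x • e 0
  have sX : ContDiffOn ℝ ∞ X U := hφ.smul contDiffOn_const
  let Z : E 2 → E 2 := fun x => e 1 - inner ℝ (push F (fun _ => e 1) x) (push F X x) • X x
  have sZ : ContDiffOn ℝ ∞ Z U := contDiffOn_const.sub
    (((contDiffOn_push hF hU contDiffOn_const).inner ℝ (contDiffOn_push hF hU sX)).smul sX)
  obtain ⟨ψ, hψ, hY⟩ := exists_normalizing_factor hU hF hinj sZ
    fun x _ h => by simpa [Z, X, e] using congrArg (fun v : E 2 => v 1) h
  refine ⟨X, fun x => ψ x • Z x, hU, hF, sX, hψ.smul sZ, hX, hY, fun x hx => ?_⟩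
  have hZ : push F Z x
      = push F (fun _ => e 1) x - inner ℝ (push F (fun _ => e 1) x) (push F X x) • push F X x := by
    simp [push, Z]
  rw [push_smul ψ, hZ, real_inner_smul_right, inner_sub_right, real_inner_smul_right, hX x hx,
    real_inner_comm, mul_one, sub_self, mul_zero]

/-- An orthonormal frame of principal directions, characterized by `α(X, Y) = 0`. -/
structure IsPrincipalFrame (F : E 2 → E N) (V : Set (E 2)) (X Y : E 2 → E 2) : Prop extends
    IsFrame F V X Y where
  conjugate : ∀ x ∈ V, normalProj F x (D² F x (X x) (Y x)) = 0

theorem IsPrincipalFrame.mono (h : IsPrincipalFrame F U X Y) (hV : IsOpen V) (hVU : V ⊆ U) :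
    IsPrincipalFrame F V X Y :=
  ⟨h.toIsFrame.mono hV hVU, fun x hx => h.conjugate x (hVU hx)⟩

theorem IsPrincipalFrame.swap (h : IsPrincipalFrame F V X Y) : IsPrincipalFrame F V Y X :=
  ⟨h.toIsFrame.swap, fun x hx => by
    rw [fderiv_fderiv_symm h.smooth h.isOpen hx]; exact h.conjugate x hx⟩

/-- By the Ricci equation all second fundamental forms `⟨α, η⟩` are diagonalized by the rotation
that diagonalizes the single one `⟨α, ξ⟩`, where `ξ` detects that `x₀` is not umbilic. -/
theorem IsFrame.exists_isPrincipalFrame (h : IsFrame F U X Y) (hflat : PatchFlatNormal F U)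
    {x₀ : E 2} (hx₀ : x₀ ∈ U)
    (hu : ¬∃ H : E N, ∀ u v, normalProj F x₀ (D² F x₀ u v)
      = inner ℝ (fderiv ℝ F x₀ u) (fderiv ℝ F x₀ v) • H) :
    ∃ V ⊆ U, x₀ ∈ V ∧ ∃ X' Y', IsPrincipalFrame F V X' Y' := by
  obtain ⟨ξ, hξ, hne⟩ := h.exists_normal_ne_zero_of_not_umbilic hx₀ hu
  let a (η : E N) (x : E 2) : ℝ := inner ℝ η (D² F x (X x) (X x) - D² F x (Y x) (Y x))
  let b (η : E N) (x : E 2) : ℝ := inner ℝ η (D² F x (X x) (Y x))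
  let z (x : E 2) : ℂ := ⟨a (normalProj F x ξ) x, 2 * b (normalProj F x ξ) x⟩
  have sF := contDiffOn_fderiv (contDiffOn_fderiv h.smooth h.isOpen) h.isOpen
  have sξ := (h.isNormalField_normalProj ξ).1
  have sa : ContDiffOn ℝ ∞ (fun x => a (normalProj F x ξ) x) U :=
    sξ.inner ℝ (((sF.clm_apply h.smooth_fst).clm_apply h.smooth_fst).sub
      ((sF.clm_apply h.smooth_snd).clm_apply h.smooth_snd))
  have sb : ContDiffOn ℝ ∞ (fun x => 2 * b (normalProj F x ξ) x) U :=
    contDiffOn_const.mul (sξ.inner ℝ ((sF.clm_apply h.smooth_fst).clm_apply h.smooth_snd))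
  have sz : ContDiffOn ℝ ∞ z U :=
    Complex.equivRealProdCLM.symm.contDiff.comp_contDiffOn (sa.prodMk sb)
  have hz₀ : z x₀ ≠ 0 := fun h0 => hne (by
    simpa [z, a, b, normalProj_of_normal hξ, Complex.ext_iff] using h0)
  obtain ⟨V, hVU, hV, hx₀V, θ, sθ, hθ⟩ := exists_contDiffOn_arg h.isOpen sz hx₀ hz₀
  have hrot := (h.mono hV hVU).rotate (θ := fun x => θ x / 2) (sθ.div_const 2)
  refine ⟨V, hVU, hx₀V, _, _, hrot, fun x hx => normalProj_eq_zero fun η hη => ?_⟩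
  obtain ⟨hzx, hpolar⟩ := hθ x hx
  have hre : a (normalProj F x ξ) x = ‖z x‖ * Real.cos (θ x) := by
    simpa [z, Complex.exp_ofReal_mul_I_re] using congrArg Complex.re hpolar
  have him : 2 * b (normalProj F x ξ) x = ‖z x‖ * Real.sin (θ x) := by
    simpa [z, Complex.exp_ofReal_mul_I_im] using congrArg Complex.im hpolar
  have hric : b (normalProj F x ξ) x * a η x = a (normalProj F x ξ) x * b η x :=
    h.ricci hflat (hVU hx) (fun u => inner_fderiv_normalProj F x u ξ) hη
  have hdouble : Real.cos (θ x) * b η x = Real.sin (θ x) * a η x / 2 := by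
    refine mul_left_cancel₀ (norm_ne_zero_iff.2 hzx) ?_
    linear_combination (-b η x) * hre + (a η x / 2) * him - hric
  have hcos : Real.cos (θ x) = Real.cos (θ x / 2) ^ 2 - Real.sin (θ x / 2) ^ 2 := by
    rw [← Real.cos_two_mul', mul_div_cancel₀ _ two_ne_zero]
  have hsin : Real.sin (θ x) = 2 * Real.sin (θ x / 2) * Real.cos (θ x / 2) := by
    rw [← Real.sin_two_mul, mul_div_cancel₀ _ two_ne_zero]
  simp only [a, b, hcos, hsin, inner_sub_right] at hdouble
  simp only [map_add, map_smul, add_apply, smul_apply, inner_add_right, real_inner_smul_right,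
    fderiv_fderiv_symm h.smooth h.isOpen (hVU hx) (Y x) (X x)]
  linarith

end Frames

/-! ### Isothermic coordinates -/

section Coordinates

variable {N : ℕ} {F : E 2 → E N} {V : Set (E 2)} {X Y : E 2 → E 2} {x : E 2}

/-- The signed geodesic curvature of the integral curves of the field `X` of an orthonormal frame
`X`, `Y`, with respect to the normal `Y`. -/
def geodCurv (F : E 2 → E N) (X Y : E 2 → E 2) (x : E 2) : ℝ :=
  inner ℝ (fderiv ℝ (push F X) x (X x)) (push F Y x)

namespace IsFrame

theorem inner_fderiv_push_fst (h : IsFrame F V X Y) (hx : x ∈ V) (v : E 2) :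
    inner ℝ (fderiv ℝ (push F X) x v) (push F X x) = 0 := by
  have hneg := inner_fderiv_of_inner_const h.isOpen h.contDiffOn_push_fst h.contDiffOn_push_fst
    h.inner_fst hx v
  rwa [real_inner_comm (fderiv ℝ _ x v) (push F X x), self_eq_neg] at hneg

theorem inner_fderiv_push_snd_fst (h : IsFrame F V X Y) (hx : x ∈ V) :
    inner ℝ (fderiv ℝ (push F Y) x (X x)) (push F X x) = -geodCurv F X Y x := by
  rw [inner_fderiv_of_inner_const h.isOpen h.contDiffOn_push_snd h.contDiffOn_push_fst
    (fun _ hy => h.inner_snd_fst hy) hx, real_inner_comm, geodCurv]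

theorem contDiffOn_geodCurv (h : IsFrame F V X Y) : ContDiffOn ℝ ∞ (geodCurv F X Y) V :=
  ((contDiffOn_fderiv h.contDiffOn_push_fst h.isOpen).clm_apply h.smooth_fst).inner ℝ
    h.contDiffOn_push_snd

theorem bilinear_symm (h : IsFrame F V X Y) (hx : x ∈ V) {B : E 2 →ₗ[ℝ] E 2 →ₗ[ℝ] ℝ}
    (hB : B (X x) (Y x) = B (Y x) (X x)) (u v : E 2) : B u v = B v u := by
  rw [h.decomp hx u, h.decomp hx v]
  simp only [map_add, map_smul, LinearMap.add_apply, LinearMap.smul_apply, smul_eq_mul, hB]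
  ring

/-- The hypothesis says that `a ω₁ + b ω₂` is closed, where `ω₁`, `ω₂` is the dual frame. -/
theorem exists_primitive (h : IsFrame F V X Y) (hconv : Convex ℝ V) {a b : E 2 → ℝ}
    (ha : ContDiffOn ℝ ∞ a V) (hb : ContDiffOn ℝ ∞ b V)
    (hclosed : ∀ x ∈ V, fderiv ℝ b x (X x) + a x * geodCurv F X Y x
      = fderiv ℝ a x (Y x) + b x * geodCurv F Y X x) :
    ∃ g : E 2 → ℝ, ContDiffOn ℝ ∞ g V ∧
      ∀ x ∈ V, fderiv ℝ g x (X x) = a x ∧ fderiv ℝ g x (Y x) = b x := by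
  let W : E 2 → E N := fun x => a x • push F X x + b x • push F Y x
  have sa := ha.smul h.contDiffOn_push_fst
  have sb := hb.smul h.contDiffOn_push_snd
  have hdW (x) (hx : x ∈ V) (u : E 2) : fderiv ℝ W x u
      = a x • fderiv ℝ (push F X) x u + fderiv ℝ a x u • push F X x
        + (b x • fderiv ℝ (push F Y) x u + fderiv ℝ b x u • push F Y x) := by
    have diff {G : Type} [NormedAddCommGroup G] [NormedSpace ℝ G] {u : E 2 → G}
        (hu : ContDiffOn ℝ ∞ u V) := differentiableAt_of_contDiffOn hu h.isOpen hx
    rw [show W = a • push F X + b • push F Y from rfl, fderiv_add (diff sa) (diff sb),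
      fderiv_smul (diff ha) (diff h.contDiffOn_push_fst),
      fderiv_smul (diff hb) (diff h.contDiffOn_push_snd)]
    rfl
  have hcross (x) (hx : x ∈ V) : inner ℝ (fderiv ℝ W x (X x)) (push F Y x)
      = inner ℝ (fderiv ℝ W x (Y x)) (push F X x) := by
    rw [hdW x hx, hdW x hx]
    simp only [inner_add_left, real_inner_smul_left, h.inner_fst x hx, h.inner_snd x hx,
      h.inner_fst_snd x hx, h.inner_snd_fst hx, h.inner_fderiv_push_fst hx,
      h.swap.inner_fderiv_push_fst hx]
    have hx_closed := hclosed x hx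
    simp only [geodCurv] at hx_closed
    linarith
  obtain ⟨g, sg, hg⟩ := Isothermic.exists_primitive h.isOpen hconv h.smooth (sa.add sb)
    fun x hx => h.bilinear_symm hx (B := ((innerSL ℝ).bilinearComp (fderiv ℝ W x)
      (fderiv ℝ F x)).toLinearMap₁₂) (hcross x hx)
  refine ⟨g, sg, fun x hx => ⟨?_, ?_⟩⟩ <;> rw [hg x hx]
  · change inner ℝ (W x) (push F X x) = _
    simp only [W, inner_add_left, real_inner_smul_left, h.inner_fst x hx, h.inner_snd_fst hx]
    ring
  · change inner ℝ (W x) (push F Y x) = _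
    simp only [W, inner_add_left, real_inner_smul_left, h.inner_snd x hx, h.inner_fst_snd x hx]
    ring

end IsFrame

theorem IsPrincipalFrame.fderiv_push_snd_fst (h : IsPrincipalFrame F V X Y) (hx : x ∈ V) :
    fderiv ℝ (push F Y) x (X x) = -geodCurv F X Y x • push F X x := by
  have htang : normalProj F x (fderiv ℝ (push F Y) x (X x)) = 0 := by
    rw [fderiv_push h.smooth h.isOpen h.smooth_snd hx]
    refine normalProj_eq_zero fun η hη => ?_
    rw [inner_add_right, real_inner_comm (fderiv ℝ F x _), hη, add_zero, real_inner_comm,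
      ← inner_normalProj hη, h.conjugate x hx, inner_zero_left]
  rw [h.normalProj_eq hx, h.swap.inner_fderiv_push_fst hx, h.inner_fderiv_push_snd_fst hx,
    zero_smul, add_zero, sub_eq_zero] at htang
  exact htang

/-- `J₁` and `J₂` are open intervals, so that `J₁ ×ˢ J₂` is a parameter rectangle. -/
structure IsBox (J₁ J₂ : Set ℝ) : Prop where
  isOpen_fst : IsOpen J₁
  ordConnected_fst : J₁.OrdConnected
  isOpen_snd : IsOpen J₂
  ordConnected_snd : J₂.OrdConnected

theorem IsBox.isOpen_prod {J₁ J₂ : Set ℝ} (h : IsBox J₁ J₂) : IsOpen (J₁ ×ˢ J₂) :=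
  h.isOpen_fst.prod h.isOpen_snd

theorem IsBox.swap {J₁ J₂ : Set ℝ} (h : IsBox J₁ J₂) : IsBox J₂ J₁ :=
  ⟨h.isOpen_snd, h.ordConnected_snd, h.isOpen_fst, h.ordConnected_fst⟩

/-- `φ` is a smooth parametrization, with smooth inverse, by the parameter rectangle `J₁ ×ˢ J₂`. -/
structure IsBoxChart {G : Type*} [NormedAddCommGroup G] [NormedSpace ℝ G] (J₁ J₂ : Set ℝ)
    (φ : OpenPartialHomeomorph (ℝ × ℝ) G) : Prop extends IsBox J₁ J₂ where
  source_eq : φ.source = J₁ ×ˢ J₂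
  contDiffOn : ContDiffOn ℝ ∞ φ φ.source
  contDiffOn_symm : ContDiffOn ℝ ∞ φ.symm φ.target

theorem exists_isBoxChart {G : Type*} [NormedAddCommGroup G] [NormedSpace ℝ G] [CompleteSpace G]
    {H : G → ℝ × ℝ} {V : Set G} (hV : IsOpen V) (hH : ContDiffOn ℝ ∞ H V)
    (hinv : ∀ x ∈ V, (fderiv ℝ H x).IsInvertible) {x₀ : G} (hx₀ : x₀ ∈ V) :
    ∃ (J₁ J₂ : Set ℝ) (φ : OpenPartialHomeomorph (ℝ × ℝ) G), IsBoxChart J₁ J₂ φ ∧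
      φ.target ⊆ V ∧ x₀ ∈ φ.target ∧
      ∀ z ∈ φ.source, fderiv ℝ φ z = (fderiv ℝ H (φ z)).inverse := by
  have hderiv (x) (hx : x ∈ V) : ∃ L : G ≃L[ℝ] ℝ × ℝ, HasFDerivAt H (L : G →L[ℝ] ℝ × ℝ) x := by
    obtain ⟨L, hL⟩ := hinv x hx
    exact ⟨L, hL ▸ (differentiableAt_of_contDiffOn hH hV hx).hasFDerivAt⟩
  obtain ⟨L₀, hL₀⟩ := hderiv x₀ hx₀
  have cH : ContDiffAt ℝ ∞ H x₀ := hH.contDiffAt (hV.mem_nhds hx₀)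
  let Φ := (cH.toOpenPartialHomeomorph H hL₀ (by simp)).restrOpen V hV
  have hΦV : Φ.source ⊆ V := inter_subset_right
  have hx₀Φ : x₀ ∈ Φ.source := ⟨cH.mem_toOpenPartialHomeomorph_source hL₀ (by simp), hx₀⟩
  obtain ⟨δ, hδ, hball⟩ := Metric.mem_nhds_iff.1 (Φ.open_target.mem_nhds (Φ.map_source hx₀Φ))
  let φ := Φ.symm.restrOpen (Metric.ball (H x₀) δ) Metric.isOpen_ball
  have hsource : φ.source = Metric.ball (H x₀) δ := inter_eq_right.2 hball
  have hφV (z) (hz : z ∈ φ.source) : φ z ∈ V := hΦV (Φ.map_target hz.1)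
  have htarget : φ.target ⊆ V := fun x hx => φ.right_inv hx ▸ hφV _ (φ.map_target hx)
  have hx₀φ : x₀ ∈ φ.target := by
    have hmap := φ.map_source (hsource ▸ Metric.mem_ball_self hδ : H x₀ ∈ φ.source)
    rwa [show φ (H x₀) = x₀ from Φ.left_inv hx₀Φ] at hmap
  refine ⟨Metric.ball (H x₀).1 δ, Metric.ball (H x₀).2 δ, φ, ⟨⟨Metric.isOpen_ball,
    (convex_ball _ δ).ordConnected, Metric.isOpen_ball, (convex_ball _ δ).ordConnected⟩,
    hsource.trans (ball_prod_same _ _ δ).symm, fun z hz => ?_, hH.mono htarget⟩, htarget, hx₀φ,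
    fun z hz => ?_⟩
  all_goals obtain ⟨L, hL⟩ := hderiv _ (hφV z hz)
  · exact (Φ.contDiffAt_symm hz.1 hL (hH.contDiffAt (hV.mem_nhds (hφV z hz)))).contDiffWithinAt
  · rw [hL.fderiv, ContinuousLinearMap.inverse_equiv]
    exact (Φ.hasFDerivAt_symm hz.1 hL).fderiv

/-- Isothermic coordinates adapted to the principal frame `X`, `Y`, with conformal factor `1 / ρ`.
-/
structure IsIsothermicChart (F : E 2 → E N) (X Y : E 2 → E 2) (ρ : E 2 → ℝ) (J₁ J₂ : Set ℝ)
    (φ : OpenPartialHomeomorph (ℝ × ℝ) (E 2)) : Prop extends IsBoxChart J₁ J₂ φ where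
  frame : IsPrincipalFrame F φ.target X Y
  contDiffOn_factor : ContDiffOn ℝ ∞ ρ φ.target
  factor_pos : ∀ x ∈ φ.target, 0 < ρ x
  fderiv_factor_fst : ∀ x ∈ φ.target, fderiv ℝ ρ x (X x) = ρ x * geodCurv F Y X x
  fderiv_factor_snd : ∀ x ∈ φ.target, fderiv ℝ ρ x (Y x) = ρ x * geodCurv F X Y x
  fderiv_fst : ∀ z ∈ φ.source, fderiv ℝ φ z (1, 0) = (ρ (φ z))⁻¹ • X (φ z)
  fderiv_snd : ∀ z ∈ φ.source, fderiv ℝ φ z (0, 1) = (ρ (φ z))⁻¹ • Y (φ z)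

/-- The form `κ_Y ω₁ + κ_X ω₂` is closed because `κ_X` and `κ_Y` are constant along the integral
curves of `X` and `Y`, and `log ρ` is a primitive of it. -/
theorem IsFrame.exists_factor (h : IsFrame F V X Y) (hconv : Convex ℝ V)
    (hX : ∀ x ∈ V, fderiv ℝ (geodCurv F X Y) x (X x) = 0)
    (hY : ∀ x ∈ V, fderiv ℝ (geodCurv F Y X) x (Y x) = 0) (x₀ : E 2) :
    ∃ ρ : E 2 → ℝ, ContDiffOn ℝ ∞ ρ V ∧ (∀ x, 0 < ρ x) ∧ ρ x₀ = 1 ∧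
      (∀ x ∈ V, fderiv ℝ ρ x (X x) = ρ x * geodCurv F Y X x) ∧
      ∀ x ∈ V, fderiv ℝ ρ x (Y x) = ρ x * geodCurv F X Y x := by
  obtain ⟨u, su, hu⟩ := h.exists_primitive hconv h.swap.contDiffOn_geodCurv h.contDiffOn_geodCurv
    fun x hx => by rw [hX x hx, hY x hx]; ring
  have hexp (x) (hx : x ∈ V) :=
    ((differentiableAt_of_contDiffOn su h.isOpen hx).hasFDerivAt.sub_const (u x₀)).exp.fderiv
  refine ⟨fun x => Real.exp (u x - u x₀), (su.sub contDiffOn_const).exp, fun x => Real.exp_pos _,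
    by simp, fun x hx => ?_, fun x hx => ?_⟩
  · rw [hexp x hx, smul_apply, (hu x hx).1, smul_eq_mul]
  · rw [hexp x hx, smul_apply, (hu x hx).2, smul_eq_mul]

theorem IsFrame.exists_coordinates (h : IsFrame F V X Y) (hconv : Convex ℝ V) {ρ : E 2 → ℝ}
    (hρ : ContDiffOn ℝ ∞ ρ V) (hX : ∀ x ∈ V, fderiv ℝ ρ x (X x) = ρ x * geodCurv F Y X x)
    (hY : ∀ x ∈ V, fderiv ℝ ρ x (Y x) = ρ x * geodCurv F X Y x) :
    ∃ H : E 2 → ℝ × ℝ, ContDiffOn ℝ ∞ H V ∧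
      ∀ x ∈ V, fderiv ℝ H x (X x) = (ρ x, 0) ∧ fderiv ℝ H x (Y x) = (0, ρ x) := by
  obtain ⟨s, ss, hs⟩ := h.exists_primitive hconv (b := fun _ => 0) hρ contDiffOn_const
    fun x hx => by rw [hY x hx, fderiv_fun_const]; simp
  obtain ⟨t, st, ht⟩ := h.exists_primitive hconv (a := fun _ => 0) contDiffOn_const hρ
    fun x hx => by rw [hX x hx, fderiv_fun_const]; simp
  refine ⟨fun x => (s x, t x), ss.prodMk st, fun x hx => ?_⟩
  rw [DifferentiableAt.fderiv_prodMk (differentiableAt_of_contDiffOn ss h.isOpen hx)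
    (differentiableAt_of_contDiffOn st h.isOpen hx)]
  simp only [ContinuousLinearMap.prod_apply, hs x hx, ht x hx, and_self]

theorem IsFrame.isInvertible_of_apply (h : IsFrame F V X Y) (hx : x ∈ V) {r : ℝ} (hr : r ≠ 0)
    {L : E 2 →L[ℝ] ℝ × ℝ} (hLX : L (X x) = (r, 0)) (hLY : L (Y x) = (0, r)) : L.IsInvertible := by
  refine .of_inverse (g := (ContinuousLinearMap.fst ℝ ℝ ℝ).smulRight (r⁻¹ • X x)
    + (ContinuousLinearMap.snd ℝ ℝ ℝ).smulRight (r⁻¹ • Y x)) ?_ ?_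
  · ext <;> simp [hLX, hLY, hr]
  · ext v : 1
    rw [h.decomp hx v]
    simp [hLX, hLY, hr, smul_smul]

theorem IsPrincipalFrame.exists_isIsothermicChart (h : IsPrincipalFrame F V X Y) {x₀ : E 2}
    (hx₀ : x₀ ∈ V) (hX : ∀ x ∈ V, fderiv ℝ (geodCurv F X Y) x (X x) = 0)
    (hY : ∀ x ∈ V, fderiv ℝ (geodCurv F Y X) x (Y x) = 0) :
    ∃ (ρ : E 2 → ℝ) (J₁ J₂ : Set ℝ) (φ : OpenPartialHomeomorph (ℝ × ℝ) (E 2)),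
      IsIsothermicChart F X Y ρ J₁ J₂ φ ∧ φ.target ⊆ V ∧ x₀ ∈ φ.target ∧ ρ x₀ = 1 := by
  obtain ⟨ε, hε, hBV⟩ := Metric.mem_nhds_iff.1 (h.isOpen.mem_nhds hx₀)
  have hB := h.mono Metric.isOpen_ball hBV
  obtain ⟨ρ, sρ, hρ, hρ₀, hρX, hρY⟩ := hB.exists_factor (convex_ball x₀ ε)
    (fun x hx => hX x (hBV hx)) (fun x hx => hY x (hBV hx)) x₀
  obtain ⟨H, sH, hH⟩ := hB.exists_coordinates (convex_ball x₀ ε) sρ hρX hρY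
  have hinv (x) (hx : x ∈ Metric.ball x₀ ε) : (fderiv ℝ H x).IsInvertible :=
    hB.isInvertible_of_apply hx (hρ x).ne' (hH x hx).1 (hH x hx).2
  obtain ⟨J₁, J₂, φ, hφ, hφB, hx₀φ, hdφ⟩ :=
    exists_isBoxChart hB.isOpen sH hinv (Metric.mem_ball_self hε)
  refine ⟨ρ, J₁, J₂, φ, ⟨hφ, hB.mono φ.open_target hφB, sρ.mono hφB, fun x _ => hρ x,
    fun x hx => hρX x (hφB hx), fun x hx => hρY x (hφB hx), fun z hz => ?_, fun z hz => ?_⟩,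
    hφB.trans hBV, hx₀φ, hρ₀⟩
  all_goals
    have hz' := hφB (φ.map_source hz)
    rw [hdφ z hz, (hinv _ hz').inverse_apply_eq, map_smul]
  · simp [(hH _ hz').1, (hρ (φ z)).ne']
  · simp [(hH _ hz').2, (hρ (φ z)).ne']

end Coordinates

/-! ### Lorentzian linear algebra -/

section Lorentz

variable {n : ℕ}

/-- The Lorentz scalar product as a bilinear form. -/
def lorForm (n : ℕ) : LinearMap.BilinForm ℝ (L n) :=
  LinearMap.mk₂ ℝ lor
    (fun X X' Y => by simp only [lor, Prod.fst_add, Prod.snd_add, inner_add_left]; ring)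
    (fun a X Y => by
      simp only [lor, Prod.smul_fst, Prod.smul_snd, real_inner_smul_left, smul_eq_mul]; ring)
    (fun X Y Y' => by simp only [lor, Prod.fst_add, Prod.snd_add, inner_add_right]; ring)
    (fun a X Y => by
      simp only [lor, Prod.smul_fst, Prod.smul_snd, real_inner_smul_right, smul_eq_mul]; ring)

theorem lorForm_apply (X Y : L n) : lorForm n X Y = lor X Y := rfl

theorem lor_comm (X Y : L n) : lor X Y = lor Y X := by
  simp only [lor, real_inner_comm X.1 Y.1, mul_comm X.2]

theorem isRefl_lorForm : (lorForm n).IsRefl := fun X Y h => by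
  rwa [lorForm_apply, lor_comm]

theorem lor_add_left (X X' Y : L n) : lor (X + X') Y = lor X Y + lor X' Y :=
  (lorForm n).map_add₂ X X' Y

theorem lor_add_right (X Y Y' : L n) : lor X (Y + Y') = lor X Y + lor X Y' :=
  (lorForm n X).map_add Y Y'

theorem lor_sub_left (X X' Y : L n) : lor (X - X') Y = lor X Y - lor X' Y :=
  (lorForm n).map_sub₂ X X' Y

theorem lor_sub_right (X Y Y' : L n) : lor X (Y - Y') = lor X Y - lor X Y' :=
  (lorForm n X).map_sub Y Y'

theorem lor_smul_left (a : ℝ) (X Y : L n) : lor (a • X) Y = a * lor X Y :=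
  (lorForm n).map_smul₂ a X Y

theorem lor_smul_right (a : ℝ) (X Y : L n) : lor X (a • Y) = a * lor X Y :=
  (lorForm n X).map_smul a Y

theorem lor_neg_neg (X Y : L n) : lor (-X) (-Y) = lor X Y :=
  ((lorForm n).map_neg₂ X (-Y)).trans (by rw [map_neg, neg_neg, lorForm_apply])

theorem lor_zero_left (Y : L n) : lor 0 Y = 0 := (lorForm n).map_zero₂ Y

theorem lor_add_self (X Y : L n) : lor (X + Y) (X + Y) = lor X X + 2 * lor X Y + lor Y Y := by
  rw [lor_add_left, lor_add_right, lor_add_right, lor_comm Y X]; ring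

theorem lor_eq_zero_of_mem_span {A B : Set (L n)} (h : ∀ x ∈ A, ∀ y ∈ B, lor x y = 0) {u v : L n}
    (hu : u ∈ Submodule.span ℝ A) (hv : v ∈ Submodule.span ℝ B) : lor u v = 0 := by
  induction hu, hv using Submodule.span_induction₂ with
  | mem_mem x y hx hy => exact h x hx y hy
  | zero_left y _ => exact lor_zero_left y
  | zero_right x _ => exact (lorForm n x).map_zero
  | add_left x y z _ _ _ hx hy => rw [lor_add_left, hx, hy, add_zero]
  | add_right x y z _ _ _ hx hy => rw [lor_add_right, hx, hy, add_zero]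
  | smul_left r x y _ _ h => rw [lor_smul_left, h, mul_zero]
  | smul_right r x y _ _ h => rw [lor_smul_right, h, mul_zero]

theorem snd_ne_zero_of_causal {u : L n} (hu : lor u u ≤ 0) (h0 : u ≠ 0) : u.2 ≠ 0 := fun h => by
  simp only [lor, real_inner_self_eq_norm_sq, h, mul_zero, sub_zero] at hu
  exact h0 (Prod.ext (norm_eq_zero.1 (pow_eq_zero_iff two_ne_zero |>.1
    (le_antisymm hu (sq_nonneg _)))) h)

theorem smul_eq_smul_of_causal {u v : L n} (hu : lor u u ≤ 0) (hv : lor v v ≤ 0)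
    (huv : lor u v = 0) : v.2 • u = u.2 • v := by
  have hself : lor (v.2 • u - u.2 • v) (v.2 • u - u.2 • v) ≤ 0 := by
    simp only [lor_sub_left, lor_sub_right, lor_smul_left, lor_smul_right, lor_comm v u, huv]
    nlinarith [mul_nonneg (sq_nonneg v.2) (neg_nonneg.2 hu),
      mul_nonneg (sq_nonneg u.2) (neg_nonneg.2 hv)]
  have hsnd : (v.2 • u - u.2 • v).2 = 0 := by simp [mul_comm]
  by_contra hne
  exact snd_ne_zero_of_causal hself (sub_ne_zero.2 hne) hsnd

/-- Orthogonal causal vectors are proportional, hence light-like. -/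
theorem orthogonal_of_causal {u v X : L n} (hu : lor u u ≤ 0) (hv : lor v v ≤ 0)
    (hv0 : v ≠ 0) (huv : lor u v = 0) (hX : lor v X = 0) : lor u X = 0 := by
  refine (mul_eq_zero.1 ?_).resolve_left (snd_ne_zero_of_causal hv hv0)
  rw [← lor_smul_left, smul_eq_smul_of_causal hu hv huv, lor_smul_left, hX, mul_zero]

/-- The subspace `W` is space-like: the Lorentz scalar product is positive definite on it. -/
def IsSpacelike (W : Submodule ℝ (L n)) : Prop := ∀ u ∈ W, u ≠ 0 → 0 < lor u u

theorem IsSpacelike.isCompl_orthogonal {W : Submodule ℝ (L n)} (hW : IsSpacelike W) :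
    IsCompl W ((lorForm n).orthogonal W) := by
  refine (LinearMap.BilinForm.isCompl_orthogonal_iff_disjoint isRefl_lorForm).2
    (Submodule.disjoint_def.2 fun u hu hu' => ?_)
  by_contra h0
  exact (hW u hu h0).ne' (hu' u hu)

/-- The reflection in the hyperplane orthogonal to `a`, for `a` not light-like. -/
def lorReflection (a : L n) : L n →ₗ[ℝ] L n :=
  LinearMap.id - ((2 / lor a a) • lorForm n a).smulRight a

theorem lorReflection_apply (a X : L n) :
    lorReflection a X = X - (2 / lor a a * lor a X) • a := rfl

theorem lor_lorReflection {a : L n} (ha : lor a a ≠ 0) (X Y : L n) :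
    lor (lorReflection a X) (lorReflection a Y) = lor X Y := by
  simp only [lorReflection_apply, lor_sub_left, lor_sub_right, lor_smul_left, lor_smul_right,
    lor_comm X a]
  field_simp
  ring

theorem lorReflection_lorReflection {a : L n} (ha : lor a a ≠ 0) (X : L n) :
    lorReflection a (lorReflection a X) = X := by
  simp only [lorReflection_apply, lor_sub_right, lor_smul_right]
  rw [sub_sub, ← add_smul, sub_eq_self]
  convert zero_smul ℝ a using 2
  field_simp
  ring

theorem lorReflection_sub {X Y : L n} (h : lor X X = lor Y Y) (hXY : lor (X - Y) (X - Y) ≠ 0) :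
    lorReflection (X - Y) X = Y := by
  have hhalf : lor (X - Y) (X - Y) = 2 * lor (X - Y) X := by
    simp only [lor_sub_left, lor_sub_right, lor_comm Y X, h]; ring
  rw [lorReflection_apply, div_mul_eq_mul_div, ← hhalf, div_self hXY, one_smul, sub_sub_cancel]

/-- The involution is the reflection that takes `τ` to `(0, √R)`, or, if `τ` is future-directed, the
opposite of the one that takes `τ` to `(0, -√R)`. -/
theorem exists_lor_involution {τ : L n} {R : ℝ} (hR : 0 < R) (hτ : lor τ τ = -R) :
    ∃ M : L n →ₗ[ℝ] L n, (∀ X Y, lor (M X) (M Y) = lor X Y) ∧ (∀ X, M (M X) = X) ∧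
      M τ = (0, √R) := by
  have hsqrt := Real.mul_self_sqrt hR.le
  have hself (r : ℝ) (hr : r * r = R) : lor τ τ = lor ((0, r) : L n) (0, r) := by
    simp [lor, hr, ← hτ]
  have hne (r : ℝ) (hr : r * r = R) (hτr : τ.2 * r ≤ 0) :
      lor (τ - (0, r)) (τ - (0, r)) ≠ 0 := by
    have hcross : lor τ (0, r) = -(τ.2 * r) := by simp [lor]
    simp only [lor_sub_left, lor_sub_right, lor_comm (0, r) τ, ← hself r hr, hτ, hcross]
    linarith
  rcases le_total τ.2 0 with h | h
  · have ha := hne _ hsqrt (mul_nonpos_of_nonpos_of_nonneg h (Real.sqrt_nonneg R))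
    exact ⟨lorReflection (τ - (0, √R)), lor_lorReflection ha, lorReflection_lorReflection ha,
      lorReflection_sub (hself _ hsqrt) ha⟩
  · have hsqrt' : -√R * -√R = R := by rw [neg_mul_neg, hsqrt]
    have ha := hne _ hsqrt' (mul_nonpos_of_nonneg_of_nonpos h (neg_nonpos.2 (Real.sqrt_nonneg R)))
    refine ⟨-lorReflection (τ - (0, -√R)), fun X Y => ?_, fun X => ?_, ?_⟩
    · rw [LinearMap.neg_apply, LinearMap.neg_apply, lor_neg_neg, lor_lorReflection ha]
    · rw [LinearMap.neg_apply, LinearMap.neg_apply, map_neg, neg_neg,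
        lorReflection_lorReflection ha]
    · rw [LinearMap.neg_apply, lorReflection_sub (hself _ hsqrt') ha]
      simp

end Lorentz

section Splittings

variable {m k N : ℕ}

/-- The splitting obtained by applying the Lorentz transformation `M`. -/
def Splitting.map (S : Splitting m k N) (M : L (N + 1) →ₗ[ℝ] L (N + 1))
    (hM : ∀ X Y, lor (M X) (M Y) = lor X Y) : Splitting m k N where
  dim := S.dim
  C := M ∘ₗ S.C
  D := M ∘ₗ S.D
  lor_C X X' := (hM _ _).trans (S.lor_C X X')
  lor_D Y Y' := (hM _ _).trans (S.lor_D Y Y')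
  lor_C_D X Y := (hM _ _).trans (S.lor_C_D X Y)

theorem exists_splitting_of_ne_bot {K : Submodule ℝ (E (N + 1))} (hK : K ≠ ⊥) :
    ∃ (m k : ℕ) (S : Splitting m k N), (∀ x ∈ K, (x, 0) ∈ LinearMap.range S.D) ∧
      (∀ x ∈ Kᗮ, ∀ r, (x, r) ∈ LinearMap.range S.C) ∧ ∀ X, (S.C X).2 = X.2 := by
  obtain ⟨k, hk⟩ := Nat.exists_eq_add_one.2
    (Nat.pos_of_ne_zero (Submodule.finrank_eq_zero.not.2 hK))
  let i : K ≃ₗᵢ[ℝ] E (k + 1) := ((stdOrthonormalBasis ℝ K).reindex (finCongr hk)).repr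
  let j := (stdOrthonormalBasis ℝ Kᗮ).repr
  have hdim : Module.finrank ℝ Kᗮ + k = N := by
    have hsum := K.finrank_add_finrank_orthogonal
    rw [hk, finrank_euclideanSpace_fin] at hsum
    omega
  refine ⟨_, k,
    { dim := hdim
      C := (Kᗮ.subtype ∘ₗ j.symm.toLinearEquiv.toLinearMap).prodMap LinearMap.id
      D := LinearMap.inl ℝ (E (N + 1)) ℝ ∘ₗ K.subtype ∘ₗ i.symm.toLinearEquiv.toLinearMap
      lor_C := fun X X' => ?_
      lor_D := fun Y Y' => ?_
      lor_C_D := fun X Y => ?_ },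
    fun x hx => ⟨i ⟨x, hx⟩, ?_⟩, fun x hx r => ⟨(j ⟨x, hx⟩, r), ?_⟩, fun X => rfl⟩
  · change inner ℝ (j.symm X.1) (j.symm X'.1) - X.2 * X'.2 = lor X X'
    rw [j.symm.inner_map_map, lor]
  · change inner ℝ (i.symm Y) (i.symm Y') - 0 * 0 = inner ℝ Y Y'
    rw [i.symm.inner_map_map, mul_zero, sub_zero]
  · change inner ℝ (j.symm X.1 : E (N + 1)) (i.symm Y) - X.2 * 0 = 0
    rw [Submodule.inner_left_of_mem_orthogonal (i.symm Y).2 (j.symm X.1).2, mul_zero, sub_zero]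
  · simp
  · simp

theorem exists_splitting_of_timelike {W : Submodule ℝ (L (N + 1))} (hW : W ≠ ⊥) {τ : L (N + 1)}
    (hτ : lor τ τ < 0) (hWτ : τ ∈ (lorForm (N + 1)).orthogonal W) :
    ∃ (m k : ℕ) (S : Splitting m k N), W ≤ LinearMap.range S.D ∧
      (lorForm (N + 1)).orthogonal W ≤ LinearMap.range S.C ∧ ∀ X, S.C X = τ → 0 < X.2 := by
  have hR : 0 < -lor τ τ := neg_pos.2 hτ
  obtain ⟨M, hM, hMM, hMτ⟩ := exists_lor_involution hR (neg_neg _).symm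
  let K : Submodule ℝ (E (N + 1)) := W.comap (M ∘ₗ LinearMap.inl ℝ (E (N + 1)) ℝ)
  have hMW (u) (hu : u ∈ W) : M u = ((M u).1, 0) := by
    have horth : lor (M u) (M τ) = 0 := (hM u τ).trans (hWτ u hu)
    rw [hMτ, lor, inner_zero_right, zero_sub, neg_eq_zero, mul_eq_zero] at horth
    exact Prod.ext rfl (horth.resolve_right (Real.sqrt_pos.2 hR).ne')
  have hMK (u) (hu : u ∈ W) : (M u).1 ∈ K := by
    change M ((M u).1, 0) ∈ W
    rwa [← hMW u hu, hMM]
  have hMKo (v) (hv : v ∈ (lorForm (N + 1)).orthogonal W) : (M v).1 ∈ Kᗮ := fun x hx => by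
    have horth : lor (M (x, 0)) v = 0 := hv _ hx
    rw [← hM, hMM] at horth
    simpa [lor] using horth
  have hK : K ≠ ⊥ := by
    obtain ⟨u, hu, hu0⟩ := W.ne_bot_iff.1 hW
    refine K.ne_bot_iff.2 ⟨(M u).1, hMK u hu, fun h0 => hu0 ?_⟩
    rw [← hMM u, hMW u hu, h0, Prod.mk_zero_zero, map_zero]
  obtain ⟨m, k, S, hD, hC, hsnd⟩ := exists_splitting_of_ne_bot hK
  refine ⟨m, k, S.map M hM, fun u hu => ?_, fun v hv => ?_, fun X hX => ?_⟩
  · obtain ⟨Y, hY⟩ := hD _ (hMK u hu)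
    exact ⟨Y, (congrArg M (hY.trans (hMW u hu).symm)).trans (hMM u)⟩
  · obtain ⟨X, hX⟩ := hC _ (hMKo v hv) (M v).2
    exact ⟨X, (congrArg M hX).trans (hMM v)⟩
  · have hSX : S.C X = (0, √(-lor τ τ)) := by rw [← hMτ, ← hX]; exact (hMM _).symm
    rw [← hsnd, hSX]
    exact Real.sqrt_pos.2 hR

end Splittings

section LightCone

variable {N : ℕ}

/-- The inclusion of `ℝ^N` in `ℝ^(N+1)` as the first `N` coordinates. -/
def inclusion (N : ℕ) : E N →ₗ[ℝ] E (N + 1) where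
  toFun x := WithLp.toLp 2 (Fin.snoc (α := fun _ => ℝ) (fun i => x i) 0)
  map_add' x y := by
    ext i
    refine Fin.lastCases ?_ (fun i => ?_) i <;> simp
  map_smul' a x := by
    ext i
    refine Fin.lastCases ?_ (fun i => ?_) i <;> simp

/-- The standard model of `ℝ^N` in the light cone. -/
def stdTriple (N : ℕ) : Triple N where
  p₀ := ((1 / 2 : ℝ) • EuclideanSpace.single (Fin.last N) 1, 1 / 2)
  w := (EuclideanSpace.single (Fin.last N) 1, -1)
  A := LinearMap.inl ℝ (E (N + 1)) ℝ ∘ₗ inclusion N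
  lor_p₀ := by
    simp only [lor, inner_smul_left, inner_smul_right, EuclideanSpace.inner_single_left]
    simp
  lor_w := by simp [lor]
  lor_p₀_w := by
    simp only [lor, inner_smul_left, EuclideanSpace.inner_single_left, PiLp.single_eq_same, map_one,
      conj_trivial]
    norm_num
  lor_A x y := by simp [lor, inclusion, PiLp.inner_apply, Fin.sum_univ_castSucc]
  lor_A_p₀ x := by simp [lor, inclusion, inner_smul_right, EuclideanSpace.inner_single_right]
  lor_A_w x := by simp [lor, inclusion, EuclideanSpace.inner_single_right]

theorem exists_stdTriple_decomposition (X : L (N + 1)) : ∃ (a b : ℝ) (y : E N),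
    X = a • (stdTriple N).p₀ + (stdTriple N).A y + b • (stdTriple N).w := by
  refine ⟨X.1 (Fin.last N) + X.2, (X.1 (Fin.last N) - X.2) / 2,
    WithLp.toLp 2 fun i => X.1 i.castSucc, Prod.ext ?_ ?_⟩
  · ext i
    refine Fin.lastCases ?_ (fun i => ?_) i
    · simp only [stdTriple, one_div, inclusion, Prod.smul_mk, smul_eq_mul, LinearMap.coe_comp,
        LinearMap.coe_inl, LinearMap.coe_mk, AddHom.coe_mk, Function.comp_apply, Prod.mk_add_mk,
        add_zero, mul_neg, mul_one, PiLp.add_apply, PiLp.smul_apply, PiLp.single_eq_same,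
        Fin.snoc_last]
      ring
    · simp [stdTriple, inclusion, Fin.castSucc_ne_last]
  · simp only [stdTriple, one_div, inclusion, Prod.smul_mk, smul_eq_mul, LinearMap.coe_comp,
      LinearMap.coe_inl, LinearMap.coe_mk, AddHom.coe_mk, Function.comp_apply, Prod.mk_add_mk,
      add_zero, mul_neg, mul_one]
    ring

namespace Triple

variable (T : Triple N)

theorem lor_Psi_w (x : E N) : lor (T.Psi x) T.w = 1 := by
  rw [Psi, lor_sub_left, lor_add_left, lor_smul_left, T.lor_p₀_w, T.lor_A_w, T.lor_w]; ring

theorem lor_Psi_A (x y : E N) : lor (T.Psi x) (T.A y) = inner ℝ x y := by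
  rw [Psi, lor_sub_left, lor_add_left, lor_smul_left, T.lor_A, lor_comm T.p₀, T.lor_A_p₀,
    lor_comm T.w, T.lor_A_w]; ring

theorem lor_Psi_Psi (x y : E N) : lor (T.Psi x) (T.Psi y) = -(1 / 2 * ‖x - y‖ ^ 2) := by
  have hp₀ : lor (T.Psi x) T.p₀ = -(1 / 2 * ‖x‖ ^ 2) := by
    rw [Psi, lor_sub_left, lor_add_left, lor_smul_left, T.lor_p₀, T.lor_A_p₀, lor_comm T.w,
      T.lor_p₀_w]; ring
  rw [show T.Psi y = T.p₀ + T.A y - ((1 / 2 : ℝ) * ‖y‖ ^ 2) • T.w from rfl, lor_sub_right,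
    lor_add_right, lor_smul_right, hp₀, lor_Psi_A, lor_Psi_w, norm_sub_sq_real]
  ring

theorem lor_Psi_self (x : E N) : lor (T.Psi x) (T.Psi x) = 0 := by
  rw [lor_Psi_Psi, sub_self, norm_zero]; norm_num

theorem Psi_injective : Function.Injective T.Psi := fun x y h => by
  refine ext_inner_right ℝ fun v => ?_
  rw [← T.lor_Psi_A, ← T.lor_Psi_A, h]

theorem toEuclidean_smul_Psi {r : ℝ} (hr : r ≠ 0) (x : E N) : T.toEuclidean (r • T.Psi x) = x := by
  rw [toEuclidean, lor_smul_left, lor_Psi_w, mul_one, smul_smul, inv_mul_cancel₀ hr, one_smul]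
  exact Function.leftInverse_invFun T.Psi_injective x

/-- The derivative of `Ψ` at `x`. -/
def dPsi (x : E N) : E N →L[ℝ] L (N + 1) :=
  LinearMap.toContinuousLinearMap T.A - (innerSL ℝ x).smulRight T.w

theorem dPsi_apply (x v : E N) : T.dPsi x v = T.A v - inner ℝ x v • T.w := rfl

theorem hasFDerivAt_Psi (x : E N) : HasFDerivAt T.Psi (T.dPsi x) x := by
  refine ((LinearMap.toContinuousLinearMap T.A).hasFDerivAt.const_add T.p₀).sub ?_
  refine ((((hasFDerivAt_id x).norm_sq).const_mul (1 / 2 : ℝ)).smul_const T.w).congr_fderiv ?_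
  ext v <;> simp

theorem contDiff_Psi : ContDiff ℝ ∞ T.Psi :=
  (contDiff_const.add (LinearMap.toContinuousLinearMap T.A).contDiff).sub
    ((contDiff_const.mul (contDiff_norm_sq ℝ)).smul contDiff_const)

theorem contDiffOn_dPsi {Z : Type*} [NormedAddCommGroup Z] [NormedSpace ℝ Z] {V : Set Z}
    {g v : Z → E N} (hg : ContDiffOn ℝ ∞ g V) (hv : ContDiffOn ℝ ∞ v V) :
    ContDiffOn ℝ ∞ (fun z => T.dPsi (g z) (v z)) V :=
  ((LinearMap.toContinuousLinearMap T.A).contDiff.comp_contDiffOn hv).sub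
    ((hg.inner ℝ hv).smul contDiffOn_const)

theorem lor_dPsi_dPsi (x u v : E N) : lor (T.dPsi x u) (T.dPsi x v) = inner ℝ u v := by
  simp only [dPsi_apply, lor_sub_left, lor_sub_right, lor_smul_left, lor_smul_right, T.lor_A,
    T.lor_A_w, T.lor_w, lor_comm T.w (T.A _)]
  ring

theorem lor_Psi_dPsi (x v : E N) : lor (T.Psi x) (T.dPsi x v) = 0 := by
  rw [dPsi_apply, lor_sub_right, lor_smul_right, lor_Psi_A, lor_Psi_w, mul_one, sub_self]

/-- The lift of `g` to the light cone with scaling factor `ρ`. -/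
def lift {Z : Type*} (ρ : Z → ℝ) (g : Z → E N) (z : Z) : L (N + 1) := ρ z • T.Psi (g z)

theorem lor_lift_self {Z : Type*} (ρ : Z → ℝ) (g : Z → E N) (z : Z) :
    lor (T.lift ρ g z) (T.lift ρ g z) = 0 := by
  rw [lift, lor_smul_left, lor_smul_right, lor_Psi_self, mul_zero, mul_zero]

variable {Z : Type*} [NormedAddCommGroup Z] [NormedSpace ℝ Z] {ρ : Z → ℝ} {g : Z → E N} {z : Z}

theorem fderiv_lift (hρ : DifferentiableAt ℝ ρ z) (hg : DifferentiableAt ℝ g z) (v : Z) :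
    fderiv ℝ (T.lift ρ g) z v
      = ρ z • T.dPsi (g z) (fderiv ℝ g z v) + fderiv ℝ ρ z v • T.Psi (g z) :=
  congrArg (fun l => l v)
    (hρ.hasFDerivAt.smul ((T.hasFDerivAt_Psi (g z)).comp z hg.hasFDerivAt)).fderiv

theorem fderiv_dPsi {v : Z → E N} (hg : DifferentiableAt ℝ g z) (hv : DifferentiableAt ℝ v z)
    (e : Z) : fderiv ℝ (fun z => T.dPsi (g z) (v z)) z e
      = T.dPsi (g z) (fderiv ℝ v z e) - inner ℝ (fderiv ℝ g z e) (v z) • T.w := by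
  have hder := ((LinearMap.toContinuousLinearMap T.A).hasFDerivAt.comp z hv.hasFDerivAt).sub
    ((hg.hasFDerivAt.inner ℝ hv.hasFDerivAt).smul_const T.w)
  have happ := congrArg (fun l => l e) hder.fderiv
  refine happ.trans ?_
  change T.A (fderiv ℝ v z e)
    - (inner ℝ (g z) (fderiv ℝ v z e) + inner ℝ (fderiv ℝ g z e) (v z)) • T.w = _
  rw [dPsi_apply, add_smul, sub_sub]

theorem lor_fderiv_lift (hρ : DifferentiableAt ℝ ρ z) (hg : DifferentiableAt ℝ g z) (u v : Z) :
    lor (fderiv ℝ (T.lift ρ g) z u) (fderiv ℝ (T.lift ρ g) z v)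
      = ρ z ^ 2 * inner ℝ (fderiv ℝ g z u) (fderiv ℝ g z v) := by
  simp only [T.fderiv_lift hρ hg, lor_add_left, lor_add_right, lor_smul_left, lor_smul_right,
    lor_dPsi_dPsi, lor_comm (T.dPsi _ _) (T.Psi _), lor_Psi_dPsi, lor_Psi_self]
  ring

end Triple

theorem exists_eq_smul_of_lor_self_eq_zero {ν : L (N + 1)} (hν : lor ν ν = 0) :
    (∃ (a : ℝ) (y : E N), ν = a • (stdTriple N).Psi y) ∨ ∃ b : ℝ, ν = b • (stdTriple N).w := by
  obtain ⟨a, b, y, rfl⟩ := exists_stdTriple_decomposition ν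
  set T := stdTriple N
  have hab : 2 * (a * b) + ‖y‖ ^ 2 = 0 := by
    simp only [lor_add_left, lor_add_right, lor_smul_left, lor_smul_right, T.lor_p₀, T.lor_p₀_w,
      T.lor_A, T.lor_A_p₀, T.lor_A_w, T.lor_w, lor_comm T.w T.p₀, lor_comm T.w (T.A y),
      lor_comm T.p₀ (T.A y), real_inner_self_eq_norm_sq] at hν
    linarith
  rcases eq_or_ne a 0 with rfl | ha
  · have hy : y = 0 := by simpa using hab
    exact Or.inr ⟨b, by simp [hy]⟩
  · refine Or.inl ⟨a, a⁻¹ • y, ?_⟩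
    have hb : b = -(a * (1 / 2 * (a⁻¹ * ‖y‖) ^ 2)) := by field_simp; linarith
    rw [Triple.Psi, norm_smul, norm_inv, Real.norm_eq_abs, mul_pow, inv_pow, sq_abs, ← inv_pow,
      ← mul_pow, smul_sub, smul_add, map_smul, smul_inv_smul₀ ha, smul_smul, sub_eq_add_neg,
      ← neg_smul, ← hb]

end LightCone

/-! ### Translation nets in the light cone -/

section Nets

variable {G : Type*} [NormedAddCommGroup G] [NormedSpace ℝ G] {J₁ J₂ : Set ℝ}

/-- On `J₁ ×ˢ J₂` the map `u` is the sum of a function of `s` and a function of `t`. -/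
def IsTranslationNet {G : Type*} [Add G] (J₁ J₂ : Set ℝ) (u : ℝ × ℝ → G) : Prop :=
  ∀ s ∈ J₁, ∀ s' ∈ J₁, ∀ t ∈ J₂, ∀ t' ∈ J₂, u (s, t) + u (s', t') = u (s, t') + u (s', t)

theorem eq_of_hasDerivAt_zero {J : Set ℝ} (hJ : IsOpen J) (hc : J.OrdConnected)
    {u : ℝ → G} (hu : ∀ s ∈ J, HasDerivAt u 0 s) {s s' : ℝ} (hs : s ∈ J) (hs' : s' ∈ J) :
    u s = u s' :=
  hJ.is_const_of_deriv_eq_zero hc.isPreconnected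
    (fun r hr => (hu r hr).differentiableAt.differentiableWithinAt) (fun r hr => (hu r hr).deriv)
    hs hs'

theorem contDiffOn_comp_swap {u : ℝ × ℝ → G} (hu : ContDiffOn ℝ ∞ u (J₁ ×ˢ J₂)) :
    ContDiffOn ℝ ∞ (u ∘ Prod.swap) (J₂ ×ˢ J₁) :=
  hu.comp (contDiff_snd.prodMk contDiff_fst).contDiffOn fun _ hz => ⟨hz.2, hz.1⟩

theorem fderiv_comp_swap (u : ℝ × ℝ → G) (z v : ℝ × ℝ) :
    fderiv ℝ (u ∘ Prod.swap) z v = fderiv ℝ u z.swap v.swap :=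
  congrArg (fun l : ℝ × ℝ →L[ℝ] G => l v)
    ((ContinuousLinearEquiv.prodComm ℝ ℝ ℝ).comp_right_fderiv (f := u) (x := z))

namespace IsBox

variable {u : ℝ × ℝ → G} {s t : ℝ}

theorem hasDerivAt_fst (h : IsBox J₁ J₂) (hu : ContDiffOn ℝ ∞ u (J₁ ×ˢ J₂)) (hs : s ∈ J₁)
    (ht : t ∈ J₂) : HasDerivAt (fun s => u (s, t)) (fderiv ℝ u (s, t) (1, 0)) s :=
  (differentiableAt_of_contDiffOn hu h.isOpen_prod ⟨hs, ht⟩).hasFDerivAt.comp_hasDerivAt s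
    ((hasDerivAt_id s).prodMk (hasDerivAt_const s t))

theorem hasDerivAt_snd (h : IsBox J₁ J₂) (hu : ContDiffOn ℝ ∞ u (J₁ ×ˢ J₂)) (hs : s ∈ J₁)
    (ht : t ∈ J₂) : HasDerivAt (fun t => u (s, t)) (fderiv ℝ u (s, t) (0, 1)) t :=
  (differentiableAt_of_contDiffOn hu h.isOpen_prod ⟨hs, ht⟩).hasFDerivAt.comp_hasDerivAt t
    ((hasDerivAt_const t s).prodMk (hasDerivAt_id t))

theorem isTranslationNet_of_hasDerivAt (h : IsBox J₁ J₂) {u w : ℝ × ℝ → G}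
    (hu : ∀ s ∈ J₁, ∀ t ∈ J₂, HasDerivAt (fun t => u (s, t)) (w (s, t)) t)
    (hw : ∀ s ∈ J₁, ∀ t ∈ J₂, HasDerivAt (fun s => w (s, t)) 0 s) :
    IsTranslationNet J₁ J₂ u := fun s hs s' hs' t ht t' ht' => by
  have hconst := eq_of_hasDerivAt_zero h.isOpen_snd h.ordConnected_snd
    (u := fun t => u (s, t) - u (s', t)) (fun r hr => by
      have hdiff := (hu s hs r hr).sub (hu s' hs' r hr)
      rwa [eq_of_hasDerivAt_zero h.isOpen_fst h.ordConnected_fst (fun q hq => hw q hq r hr) hs hs',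
        sub_self] at hdiff) ht ht'
  rwa [sub_eq_sub_iff_add_eq_add] at hconst

end IsBox

namespace IsTranslationNet

theorem congr {G : Type*} [Add G] {u w : ℝ × ℝ → G} (hu : IsTranslationNet J₁ J₂ u)
    (h : EqOn w u (J₁ ×ˢ J₂)) : IsTranslationNet J₁ J₂ w := fun s hs s' hs' t ht t' ht' => by
  rw [h ⟨hs, ht⟩, h ⟨hs', ht'⟩, h ⟨hs, ht'⟩, h ⟨hs', ht⟩]
  exact hu s hs s' hs' t ht t' ht'

theorem comp_swap {G : Type*} [AddCommMagma G] {u : ℝ × ℝ → G} (hu : IsTranslationNet J₁ J₂ u) :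
    IsTranslationNet J₂ J₁ (u ∘ Prod.swap) := fun s hs s' hs' t ht t' ht' =>
  (hu t ht t' ht' s hs s' hs').trans (add_comm _ _)

theorem eq_add_sub {G : Type*} [AddGroup G] {u : ℝ × ℝ → G} {s s' t t' : ℝ}
    (hu : IsTranslationNet J₁ J₂ u) (hs : s ∈ J₁) (hs' : s' ∈ J₁) (ht : t ∈ J₂) (ht' : t' ∈ J₂) :
    u (s, t) = u (s, t') + u (s', t) - u (s', t') :=
  eq_sub_of_add_eq (hu s hs s' hs' t ht t' ht')

variable {u : ℝ × ℝ → G} {s s' t t' : ℝ}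

theorem fderiv_fst_eq (hu : IsTranslationNet J₁ J₂ u) (h : IsBox J₁ J₂)
    (sm : ContDiffOn ℝ ∞ u (J₁ ×ˢ J₂)) (hs : s ∈ J₁) (ht : t ∈ J₂) (ht' : t' ∈ J₂) :
    fderiv ℝ u (s, t) (1, 0) = fderiv ℝ u (s, t') (1, 0) := by
  refine (h.hasDerivAt_fst sm hs ht).unique
    ((((h.hasDerivAt_fst sm hs ht').add_const (u (s, t))).sub_const
      (u (s, t'))).congr_of_eventuallyEq ?_)
  filter_upwards [h.isOpen_fst.mem_nhds hs] with r hr using hu.eq_add_sub hr hs ht ht'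

theorem fderiv_snd_eq (hu : IsTranslationNet J₁ J₂ u) (h : IsBox J₁ J₂)
    (sm : ContDiffOn ℝ ∞ u (J₁ ×ˢ J₂)) (hs : s ∈ J₁) (hs' : s' ∈ J₁) (ht : t ∈ J₂) :
    fderiv ℝ u (s, t) (0, 1) = fderiv ℝ u (s', t) (0, 1) := by
  have hswap := hu.comp_swap.fderiv_fst_eq h.swap (contDiffOn_comp_swap sm) ht hs hs'
  simpa only [fderiv_comp_swap, Prod.swap_prod_mk] using hswap

theorem bilin_sub_sub (hu : IsTranslationNet J₁ J₂ u) (h : IsBox J₁ J₂)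
    (sm : ContDiffOn ℝ ∞ u (J₁ ×ˢ J₂)) {B : G →L[ℝ] G →L[ℝ] ℝ}
    (hB : ∀ z ∈ J₁ ×ˢ J₂, B (fderiv ℝ u z (1, 0)) (fderiv ℝ u z (0, 1)) = 0)
    (hs : s ∈ J₁) (hs' : s' ∈ J₁) (ht : t ∈ J₂) (ht' : t' ∈ J₂) :
    B (u (s, t') - u (s', t')) (u (s', t) - u (s', t')) = 0 := by
  have hnet := h.isTranslationNet_of_hasDerivAt
    (u := fun z => B (u (z.1, t') - u (s', t')) (u (s', z.2) - u (s', t')))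
    (w := fun z => B (u (z.1, t') - u (s', t')) (fderiv ℝ u (s', z.2) (0, 1)))
    (fun r _ q hq => (B (u (r, t') - u (s', t'))).hasFDerivAt.comp_hasDerivAt q
      ((h.hasDerivAt_snd sm hs' hq).sub_const _))
    (fun r hr q hq => by
      have horth := hB (r, q) ⟨hr, hq⟩
      rw [hu.fderiv_fst_eq h sm hr hq ht', hu.fderiv_snd_eq h sm hr hs' hq] at horth
      have hder := (B.flip (fderiv ℝ u (s', q) (0, 1))).hasFDerivAt.comp_hasDerivAt r
        ((h.hasDerivAt_fst sm hr ht').sub_const (u (s', t')))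
      rw [B.flip_apply, horth] at hder
      exact hder)
  simpa using hnet s hs s' hs' t ht t' ht'

end IsTranslationNet

/-- The patch `g` is parametrized by `J₁ ×ˢ J₂` with induced metric `ρ⁻² (ds² + dt²)`. -/
structure IsConformalNet {N : ℕ} (J₁ J₂ : Set ℝ) (ρ : ℝ × ℝ → ℝ) (g : ℝ × ℝ → E N) : Prop
    extends IsBox J₁ J₂ where
  contDiffOn : ContDiffOn ℝ ∞ g (J₁ ×ˢ J₂)
  contDiffOn_factor : ContDiffOn ℝ ∞ ρ (J₁ ×ˢ J₂)
  factor_pos : ∀ z ∈ J₁ ×ˢ J₂, 0 < ρ z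
  inner_fst : ∀ z ∈ J₁ ×ˢ J₂,
    inner ℝ (fderiv ℝ g z (1, 0)) (fderiv ℝ g z (1, 0)) = (ρ z ^ 2)⁻¹
  inner_snd : ∀ z ∈ J₁ ×ˢ J₂,
    inner ℝ (fderiv ℝ g z (0, 1)) (fderiv ℝ g z (0, 1)) = (ρ z ^ 2)⁻¹
  inner_fst_snd : ∀ z ∈ J₁ ×ˢ J₂, inner ℝ (fderiv ℝ g z (1, 0)) (fderiv ℝ g z (0, 1)) = 0

/-- A conformal net whose lift to the light cone is a translation net. -/
structure IsIsothermicNet {N : ℕ} (J₁ J₂ : Set ℝ) (ρ : ℝ × ℝ → ℝ) (g : ℝ × ℝ → E N) : Prop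
    extends IsConformalNet J₁ J₂ ρ g where
  isTranslationNet_lift (T : Triple N) : IsTranslationNet J₁ J₂ (T.lift ρ g)

variable {N : ℕ} {ρ : ℝ × ℝ → ℝ} {g : ℝ × ℝ → E N}

namespace IsConformalNet

theorem comp_swap (h : IsConformalNet J₁ J₂ ρ g) :
    IsConformalNet J₂ J₁ (ρ ∘ Prod.swap) (g ∘ Prod.swap) where
  toIsBox := h.toIsBox.swap
  contDiffOn := contDiffOn_comp_swap h.contDiffOn
  contDiffOn_factor := contDiffOn_comp_swap h.contDiffOn_factor
  factor_pos z hz := h.factor_pos z.swap hz.symm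
  inner_fst z hz := by
    simpa only [fderiv_comp_swap, Prod.swap_prod_mk, Function.comp_apply]
      using h.inner_snd z.swap hz.symm
  inner_snd z hz := by
    simpa only [fderiv_comp_swap, Prod.swap_prod_mk, Function.comp_apply]
      using h.inner_fst z.swap hz.symm
  inner_fst_snd z hz := by
    rw [real_inner_comm]
    simpa only [fderiv_comp_swap, Prod.swap_prod_mk] using h.inner_fst_snd z.swap hz.symm

variable (h : IsConformalNet J₁ J₂ ρ g) {z : ℝ × ℝ}
include h

theorem differentiableAt (hz : z ∈ J₁ ×ˢ J₂) : DifferentiableAt ℝ g z :=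
  differentiableAt_of_contDiffOn h.contDiffOn h.isOpen_prod hz

theorem differentiableAt_factor (hz : z ∈ J₁ ×ˢ J₂) : DifferentiableAt ℝ ρ z :=
  differentiableAt_of_contDiffOn h.contDiffOn_factor h.isOpen_prod hz

theorem contDiffOn_lift (T : Triple N) : ContDiffOn ℝ ∞ (T.lift ρ g) (J₁ ×ˢ J₂) :=
  h.contDiffOn_factor.smul (T.contDiff_Psi.comp_contDiffOn h.contDiffOn)

theorem lor_fderiv_lift_fst (T : Triple N) (hz : z ∈ J₁ ×ˢ J₂) :
    lor (fderiv ℝ (T.lift ρ g) z (1, 0)) (fderiv ℝ (T.lift ρ g) z (1, 0)) = 1 := by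
  rw [T.lor_fderiv_lift (h.differentiableAt_factor hz) (h.differentiableAt hz), h.inner_fst z hz,
    mul_inv_cancel₀ (pow_ne_zero 2 (h.factor_pos z hz).ne')]

theorem lor_fderiv_lift_snd (T : Triple N) (hz : z ∈ J₁ ×ˢ J₂) :
    lor (fderiv ℝ (T.lift ρ g) z (0, 1)) (fderiv ℝ (T.lift ρ g) z (0, 1)) = 1 := by
  rw [T.lor_fderiv_lift (h.differentiableAt_factor hz) (h.differentiableAt hz), h.inner_snd z hz,
    mul_inv_cancel₀ (pow_ne_zero 2 (h.factor_pos z hz).ne')]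

theorem lor_fderiv_lift_fst_snd (T : Triple N) (hz : z ∈ J₁ ×ˢ J₂) :
    lor (fderiv ℝ (T.lift ρ g) z (1, 0)) (fderiv ℝ (T.lift ρ g) z (0, 1)) = 0 := by
  rw [T.lor_fderiv_lift (h.differentiableAt_factor hz) (h.differentiableAt hz),
    h.inner_fst_snd z hz, mul_zero]

end IsConformalNet

namespace IsIsothermicNet

theorem comp_swap (h : IsIsothermicNet J₁ J₂ ρ g) :
    IsIsothermicNet J₂ J₁ (ρ ∘ Prod.swap) (g ∘ Prod.swap) :=
  ⟨h.toIsConformalNet.comp_swap, fun T => (h.isTranslationNet_lift T).comp_swap⟩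

theorem isTranslationNet_center (h : IsIsothermicNet J₁ J₂ ρ g) (y : E N) :
    IsTranslationNet J₁ J₂ fun z => ρ z • (g z - y) + y := fun s hs s' hs' t ht t' ht' => by
  refine ext_inner_right ℝ fun v => ?_
  let T := stdTriple N
  have hlift (z) : inner ℝ (ρ z • (g z - y) + y) v
      = lor (T.lift ρ g z) (T.A v - inner ℝ y v • T.w) + inner ℝ y v := by
    rw [Triple.lift, lor_smul_left, lor_sub_right, lor_smul_right, T.lor_Psi_A, T.lor_Psi_w,
      inner_add_left, real_inner_smul_left, inner_sub_left, mul_one]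
  have hsum := congrArg (fun X => lor X (T.A v - inner ℝ y v • T.w))
    (h.isTranslationNet_lift T s hs s' hs' t ht t' ht')
  simp only [lor_add_left] at hsum
  rw [inner_add_left (ρ (s, t) • _ + y), inner_add_left (ρ (s, t') • _ + y)]
  simp only [hlift]
  linarith

theorem lor_lift_sub_lift_sub (h : IsIsothermicNet J₁ J₂ ρ g) (T : Triple N) {s s' t t' : ℝ}
    (hs : s ∈ J₁) (hs' : s' ∈ J₁) (ht : t ∈ J₂) (ht' : t' ∈ J₂) :
    lor (T.lift ρ g (s, t') - T.lift ρ g (s', t')) (T.lift ρ g (s', t) - T.lift ρ g (s', t'))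
      = 0 :=
  (h.isTranslationNet_lift T).bilin_sub_sub h.toIsBox (h.contDiffOn_lift T)
    (B := (lorForm (N + 1)).toContinuousBilinearMap)
    (fun _ hz => h.lor_fderiv_lift_fst_snd T hz) hs hs' ht ht'

end IsIsothermicNet

end Nets

section ChartNet

variable {N : ℕ} {F : E 2 → E N} {X Y : E 2 → E 2} {ρ : E 2 → ℝ} {J₁ J₂ : Set ℝ}
  {φ : OpenPartialHomeomorph (ℝ × ℝ) (E 2)}

namespace IsIsothermicChart

theorem contDiffOn_comp (h : IsIsothermicChart F X Y ρ J₁ J₂ φ) {G : Type*} [NormedAddCommGroup G]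
    [NormedSpace ℝ G] {u : E 2 → G} (hu : ContDiffOn ℝ ∞ u φ.target) :
    ContDiffOn ℝ ∞ (u ∘ φ) (J₁ ×ˢ J₂) := by
  rw [← h.source_eq]
  exact hu.comp h.contDiffOn fun z hz => φ.map_source hz

theorem fderiv_comp (h : IsIsothermicChart F X Y ρ J₁ J₂ φ) {G : Type*} [NormedAddCommGroup G]
    [NormedSpace ℝ G] {u : E 2 → G} (hu : ContDiffOn ℝ ∞ u φ.target) {z : ℝ × ℝ}
    (hz : z ∈ J₁ ×ˢ J₂) :
    fderiv ℝ (u ∘ φ) z (1, 0) = (ρ (φ z))⁻¹ • fderiv ℝ u (φ z) (X (φ z)) ∧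
      fderiv ℝ (u ∘ φ) z (0, 1) = (ρ (φ z))⁻¹ • fderiv ℝ u (φ z) (Y (φ z)) := by
  rw [← h.source_eq] at hz
  rw [_root_.fderiv_comp z (differentiableAt_of_contDiffOn hu φ.open_target (φ.map_source hz))
    (differentiableAt_of_contDiffOn h.contDiffOn φ.open_source hz),
    ← map_smul, ← map_smul, ← h.fderiv_fst z hz, ← h.fderiv_snd z hz]
  exact ⟨rfl, rfl⟩

theorem isTranslationNet (h : IsIsothermicChart F X Y ρ J₁ J₂ φ) {G : Type*}
    [NormedAddCommGroup G] [NormedSpace ℝ G] {u w : E 2 → G} (hu : ContDiffOn ℝ ∞ u φ.target)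
    (hw : ContDiffOn ℝ ∞ w φ.target) (huw : ∀ x ∈ φ.target, fderiv ℝ u x (Y x) = ρ x • w x)
    (hw0 : ∀ x ∈ φ.target, fderiv ℝ w x (X x) = 0) : IsTranslationNet J₁ J₂ (u ∘ φ) := by
  have hmem (z) (hz : z ∈ J₁ ×ˢ J₂) : φ z ∈ φ.target := φ.map_source (h.source_eq ▸ hz)
  refine h.isTranslationNet_of_hasDerivAt (w := w ∘ φ) (fun s hs t ht => ?_) fun s hs t ht => ?_
  · convert h.hasDerivAt_snd (h.contDiffOn_comp hu) hs ht using 1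
    rw [(h.fderiv_comp hu ⟨hs, ht⟩).2, huw _ (hmem _ ⟨hs, ht⟩),
      inv_smul_smul₀ (h.factor_pos _ (hmem _ ⟨hs, ht⟩)).ne', Function.comp_apply]
  · convert h.hasDerivAt_fst (h.contDiffOn_comp hw) hs ht using 1
    rw [(h.fderiv_comp hw ⟨hs, ht⟩).1, hw0 _ (hmem _ ⟨hs, ht⟩), smul_zero]

theorem isConformalNet (h : IsIsothermicChart F X Y ρ J₁ J₂ φ) :
    IsConformalNet J₁ J₂ (ρ ∘ φ) (F ∘ φ) := by
  have hmem (z) (hz : z ∈ J₁ ×ˢ J₂) : φ z ∈ φ.target := φ.map_source (h.source_eq ▸ hz)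
  refine ⟨h.toIsBox, h.contDiffOn_comp h.frame.smooth, h.contDiffOn_comp h.contDiffOn_factor,
    fun z hz => h.factor_pos _ (hmem z hz), fun z hz => ?_, fun z hz => ?_, fun z hz => ?_⟩
  all_goals
    simp only [h.fderiv_comp h.frame.smooth hz, real_inner_smul_left, real_inner_smul_right]
  · have hin := h.frame.inner_fst _ (hmem z hz)
    simp only [push] at hin
    rw [hin, Function.comp_apply, sq, mul_inv, mul_one]
  · have hin := h.frame.inner_snd _ (hmem z hz)
    simp only [push] at hin
    rw [hin, Function.comp_apply, sq, mul_inv, mul_one]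
  · have hin := h.frame.inner_fst_snd _ (hmem z hz)
    simp only [push] at hin
    rw [hin, mul_zero, mul_zero]

/-- The lift `u` satisfies `Y u = ρ w` with `w = κ Ψ(F) + dΨ(F_* Y)`, `κ` the geodesic curvature of
the `X`-lines, and `X w = 0`. -/
theorem isIsothermicNet (h : IsIsothermicChart F X Y ρ J₁ J₂ φ)
    (hX : ∀ x ∈ φ.target, fderiv ℝ (geodCurv F X Y) x (X x) = 0) :
    IsIsothermicNet J₁ J₂ (ρ ∘ φ) (F ∘ φ) := by
  refine ⟨h.isConformalNet, fun T => ?_⟩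
  have hF {x} (hx : x ∈ φ.target) : DifferentiableAt ℝ F x :=
    differentiableAt_of_contDiffOn h.frame.smooth h.frame.isOpen hx
  have sκ := h.frame.contDiffOn_geodCurv
  have hκ {x} (hx : x ∈ φ.target) := differentiableAt_of_contDiffOn sκ h.frame.isOpen hx
  have sPY := h.frame.contDiffOn_push_snd
  have hPY {x} (hx : x ∈ φ.target) := differentiableAt_of_contDiffOn sPY h.frame.isOpen hx
  have sΨ := T.contDiff_Psi.comp_contDiffOn h.frame.smooth
  refine h.isTranslationNet (u := T.lift ρ F)
    (w := T.lift (geodCurv F X Y) F + fun x => T.dPsi (F x) (push F Y x))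
    (h.contDiffOn_factor.smul sΨ) ((sκ.smul sΨ).add (T.contDiffOn_dPsi h.frame.smooth sPY))
    (fun x hx => ?_) fun x hx => ?_
  · rw [T.fderiv_lift (differentiableAt_of_contDiffOn h.contDiffOn_factor h.frame.isOpen hx)
      (hF hx), h.fderiv_factor_snd x hx, mul_smul, ← smul_add, add_comm (T.dPsi _ _)]
    rfl
  · have hinner : inner ℝ (fderiv ℝ F x (X x)) (push F Y x) = 0 := h.frame.inner_fst_snd x hx
    have hlift : DifferentiableAt ℝ (T.lift (geodCurv F X Y) F) x :=
      differentiableAt_of_contDiffOn (sκ.smul sΨ) h.frame.isOpen hx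
    have hdPsi : DifferentiableAt ℝ (fun x => T.dPsi (F x) (push F Y x)) x :=
      differentiableAt_of_contDiffOn (T.contDiffOn_dPsi h.frame.smooth sPY) h.frame.isOpen hx
    rw [fderiv_add hlift hdPsi, add_apply, T.fderiv_lift (hκ hx) (hF hx),
      T.fderiv_dPsi (hF hx) (hPY hx), h.frame.fderiv_push_snd_fst hx, hX x hx, hinner, map_smul,
      push]
    module

end IsIsothermicChart

end ChartNet

section Products

variable {N : ℕ} {J J₁ J₂ : Set ℝ}

theorem IsBox.contDiffOn_fst {G : Type*} [NormedAddCommGroup G] [NormedSpace ℝ G]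
    {u : ℝ × ℝ → G} (hu : ContDiffOn ℝ ∞ u (J₁ ×ˢ J₂)) {t : ℝ} (ht : t ∈ J₂) :
    ContDiffOn ℝ ∞ (fun s => u (s, t)) J₁ :=
  hu.comp (contDiff_id.prodMk contDiff_const).contDiffOn fun _ hs => ⟨hs, ht⟩

theorem IsBox.contDiffOn_snd {G : Type*} [NormedAddCommGroup G] [NormedSpace ℝ G]
    {u : ℝ × ℝ → G} (hu : ContDiffOn ℝ ∞ u (J₁ ×ˢ J₂)) {s : ℝ} (hs : s ∈ J₁) :
    ContDiffOn ℝ ∞ (fun t => u (s, t)) J₂ :=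
  hu.comp (contDiff_const.prodMk contDiff_id).contDiffOn fun _ ht => ⟨hs, ht⟩

theorem exists_contDiffOn_lift {G H : Type*} [NormedAddCommGroup G] [NormedSpace ℝ G]
    [NormedAddCommGroup H] [NormedSpace ℝ H] [FiniteDimensional ℝ H] (hJ : IsOpen J)
    (T : G →ₗ[ℝ] H) {a : ℝ → H} (ha : ContDiffOn ℝ ∞ a J)
    (hrange : ∀ s ∈ J, a s ∈ LinearMap.range T) :
    ∃ α : ℝ → G, ContDiffOn ℝ ∞ α J ∧ ∀ s ∈ J, T (α s) = a s ∧ T (deriv α s) = deriv a s := by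
  obtain ⟨σ, hσ⟩ := T.rangeRestrict.exists_rightInverse_of_surjective T.range_rangeRestrict
  obtain ⟨Λ, hΛ⟩ := σ.exists_extend
  have hTΛ {s} (hs : s ∈ J) : T (Λ (a s)) = a s := by
    obtain ⟨y, hy⟩ : ∃ y : LinearMap.range T, (y : H) = a s := ⟨⟨_, hrange s hs⟩, rfl⟩
    rw [← hy, show Λ y = σ y from LinearMap.congr_fun hΛ y]
    exact congrArg Subtype.val (LinearMap.congr_fun hσ y)
  refine ⟨fun s => Λ (a s), (LinearMap.toContinuousLinearMap Λ).contDiff.comp_contDiffOn ha,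
    fun s hs => ⟨hTΛ hs, ?_⟩⟩
  have hda := (differentiableAt_of_contDiffOn ha hJ hs).hasDerivAt
  have hΛa : HasDerivAt (fun s => Λ (a s)) (Λ (deriv a s)) s :=
    (LinearMap.toContinuousLinearMap Λ).hasFDerivAt.comp_hasDerivAt s hda
  have hTΛa : HasDerivAt (fun s => T (Λ (a s))) (T (Λ (deriv a s))) s :=
    (LinearMap.toContinuousLinearMap (T ∘ₗ Λ)).hasFDerivAt.comp_hasDerivAt s hda
  rw [hΛa.deriv]
  refine hTΛa.unique (hda.congr_of_eventuallyEq ?_)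
  filter_upwards [hJ.mem_nhds hs] with r hr using hTΛ hr

theorem exists_isUnitSpeed {n : ℕ} (hJ : IsOpen J) (i : E n →ₗᵢ[ℝ] E N) {a : ℝ → E N}
    (ha : ContDiffOn ℝ ∞ a J) (hrange : ∀ s ∈ J, a s ∈ LinearMap.range i.toLinearMap)
    (hspeed : ∀ s ∈ J, inner ℝ (deriv a s) (deriv a s) = 1) :
    ∃ α : ℝ → E n, IsUnitSpeed α J ∧ ∀ s ∈ J, i (α s) = a s := by
  obtain ⟨α, hα, hiα⟩ := exists_contDiffOn_lift hJ i.toLinearMap ha hrange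
  refine ⟨α, ⟨hα, fun s hs => ?_⟩, fun s hs => (hiα s hs).1⟩
  rw [← i.norm_map, show i (deriv α s) = _ from (hiα s hs).2, norm_eq_sqrt_real_inner, hspeed s hs,
    Real.sqrt_one]

theorem exists_isometryEquiv_of_submodule (K : Submodule ℝ (E N)) (c : E N) :
    ∃ (N₁ N₂ : ℕ) (i : E N₁ →ₗᵢ[ℝ] E N) (j : E N₂ →ₗᵢ[ℝ] E N)
      (Φ : WithLp 2 (E N₁ × E N₂) ≃ᵢ E N), LinearMap.range i.toLinearMap = K ∧
      LinearMap.range j.toLinearMap = Kᗮ ∧ ∀ x y, Φ (WithLp.toLp 2 (x, y)) = c + (i x + j y) := by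
  let e₁ := (stdOrthonormalBasis ℝ K).repr.symm
  let e₂ := (stdOrthonormalBasis ℝ Kᗮ).repr.symm
  refine ⟨_, _, K.subtypeₗᵢ.comp e₁.toLinearIsometry, Kᗮ.subtypeₗᵢ.comp e₂.toLinearIsometry,
    ((e₁.withLpProdCongr 2 e₂).trans
      K.orthogonalDecomposition.symm).toIsometryEquiv.trans (IsometryEquiv.addLeft c), ?_, ?_,
    fun x y => ?_⟩
  · exact (LinearMap.range_comp_of_range_eq_top K.subtype e₁.toLinearEquiv.range).trans
      K.range_subtype
  · exact (LinearMap.range_comp_of_range_eq_top Kᗮ.subtype e₂.toLinearEquiv.range).trans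
      Kᗮ.range_subtype
  · rfl

theorem IsConformalNet.exists_product {ρ : ℝ × ℝ → ℝ} {g : ℝ × ℝ → E N}
    (h : IsConformalNet J₁ J₂ ρ g) (hρ : ∀ z ∈ J₁ ×ˢ J₂, ρ z = 1) (hnet : IsTranslationNet J₁ J₂ g)
    {z₀ : ℝ × ℝ} (hz₀ : z₀ ∈ J₁ ×ˢ J₂) :
    ∃ (N₁ N₂ : ℕ) (Φ : WithLp 2 (E N₁ × E N₂) ≃ᵢ E N) (α : ℝ → E N₁) (β : ℝ → E N₂),
      IsUnitSpeed α J₁ ∧ IsUnitSpeed β J₂ ∧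
      ∀ s ∈ J₁, ∀ t ∈ J₂, g (s, t) = Φ (WithLp.toLp 2 (α s, β t)) := by
  obtain ⟨s₀, t₀⟩ := z₀
  obtain ⟨hs₀ : s₀ ∈ J₁, ht₀ : t₀ ∈ J₂⟩ := hz₀
  let p : ℝ → E N := fun s => g (s, t₀) - g (s₀, t₀)
  let q : ℝ → E N := fun t => g (s₀, t) - g (s₀, t₀)
  have hpq (s) (hs : s ∈ J₁) (t) (ht : t ∈ J₂) : inner ℝ (p s) (q t) = 0 :=
    hnet.bilin_sub_sub h.toIsBox h.contDiffOn (B := innerSL ℝ) h.inner_fst_snd hs hs₀ ht ht₀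
  let K : Submodule ℝ (E N) := Submodule.span ℝ (p '' J₁)
  have hqK (t) (ht : t ∈ J₂) : q t ∈ Kᗮ := by
    have hK : K ≤ (ℝ ∙ q t)ᗮ := Submodule.span_le.2 (image_subset_iff.2 fun s hs =>
      Submodule.mem_orthogonal_singleton_iff_inner_left.2 (hpq s hs t ht))
    exact Submodule.mem_orthogonal _ _ |>.2 fun u hu =>
      Submodule.mem_orthogonal_singleton_iff_inner_left.1 (hK hu)
  obtain ⟨N₁, N₂, i, j, Φ, hi, hj, hΦ⟩ := exists_isometryEquiv_of_submodule K (g (s₀, t₀))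
  obtain ⟨α, hα, hiα⟩ := exists_isUnitSpeed h.isOpen_fst i (a := p)
    ((IsBox.contDiffOn_fst h.contDiffOn ht₀).sub contDiffOn_const)
    (fun s hs => hi.ge (Submodule.subset_span (mem_image_of_mem p hs))) fun s hs => by
      rw [((h.hasDerivAt_fst h.contDiffOn hs ht₀).sub_const _).deriv, h.inner_fst _ ⟨hs, ht₀⟩,
        hρ _ ⟨hs, ht₀⟩, one_pow, inv_one]
  obtain ⟨β, hβ, hjβ⟩ := exists_isUnitSpeed h.isOpen_snd j (a := q)
    ((IsBox.contDiffOn_snd h.contDiffOn hs₀).sub contDiffOn_const)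
    (fun t ht => hj.ge (hqK t ht)) fun t ht => by
      rw [((h.hasDerivAt_snd h.contDiffOn hs₀ ht).sub_const _).deriv, h.inner_snd _ ⟨hs₀, ht⟩,
        hρ _ ⟨hs₀, ht⟩, one_pow, inv_one]
  refine ⟨N₁, N₂, Φ, α, β, hα, hβ, fun s hs t ht => ?_⟩
  simp only [hΦ, hiα s hs, hjβ t ht, hnet.eq_add_sub hs hs₀ ht ht₀, p, q]
  abel

/-- `g` is the composition of a product of two curves of unit speed with an inversion. -/
def IsInvertedProduct (J₁ J₂ : Set ℝ) (g : ℝ × ℝ → E N) : Prop :=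
  ∃ (N₁ N₂ : ℕ) (Φ : WithLp 2 (E N₁ × E N₂) ≃ᵢ E N) (I : E N → E N) (α : ℝ → E N₁) (β : ℝ → E N₂),
    IsUnitSpeed α J₁ ∧ IsUnitSpeed β J₂ ∧
    IsInversionOn I {x | ∃ s ∈ J₁, ∃ t ∈ J₂, x = Φ (WithLp.toLp 2 (α s, β t))} ∧
    ∀ s ∈ J₁, ∀ t ∈ J₂, g (s, t) = I (Φ (WithLp.toLp 2 (α s, β t)))

theorem IsConformalNet.inversion {ρ : ℝ × ℝ → ℝ} {g : ℝ × ℝ → E N} (h : IsConformalNet J₁ J₂ ρ g)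
    {y : E N} {R : ℝ} (hy : ∀ z ∈ J₁ ×ˢ J₂, g z ≠ y)
    (hR : ∀ z ∈ J₁ ×ˢ J₂, (R / dist (g z) y) ^ 2 = ρ z) :
    IsConformalNet J₁ J₂ 1 (EuclideanGeometry.inversion y R ∘ g) := by
  have hinner (z) (hz : z ∈ J₁ ×ˢ J₂) (u v : ℝ × ℝ) :
      inner ℝ (fderiv ℝ (EuclideanGeometry.inversion y R ∘ g) z u)
        (fderiv ℝ (EuclideanGeometry.inversion y R ∘ g) z v)
      = ρ z ^ 2 * inner ℝ (fderiv ℝ g z u) (fderiv ℝ g z v) := by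
    have hder := (EuclideanGeometry.hasFDerivAt_inversion (R := R) (hy z hz)).comp z
      (h.differentiableAt hz).hasFDerivAt
    rw [hder.fderiv, hR z hz]
    change inner ℝ (ρ z • (ℝ ∙ (g z - y))ᗮ.reflection (fderiv ℝ g z u))
      (ρ z • (ℝ ∙ (g z - y))ᗮ.reflection (fderiv ℝ g z v)) = _
    rw [real_inner_smul_left, real_inner_smul_right, LinearIsometryEquiv.inner_map_map]
    ring
  have hone (z) (hz : z ∈ J₁ ×ˢ J₂) : ρ z ^ 2 * (ρ z ^ 2)⁻¹ = ((1 : ℝ × ℝ → ℝ) z ^ 2)⁻¹ := by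
    rw [mul_inv_cancel₀ (pow_ne_zero 2 (h.factor_pos z hz).ne'), Pi.one_apply, one_pow, inv_one]
  exact
    { toIsBox := h.toIsBox
      contDiffOn := contDiffOn_const.inversion contDiffOn_const h.contDiffOn hy
      contDiffOn_factor := contDiffOn_const
      factor_pos := fun _ _ => one_pos
      inner_fst := fun z hz => by rw [hinner z hz, h.inner_fst z hz, hone z hz]
      inner_snd := fun z hz => by rw [hinner z hz, h.inner_snd z hz, hone z hz]
      inner_fst_snd := fun z hz => by rw [hinner z hz, h.inner_fst_snd z hz, mul_zero] }

namespace IsIsothermicNet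

variable {ρ : ℝ × ℝ → ℝ} {g : ℝ × ℝ → E N} (h : IsIsothermicNet J₁ J₂ ρ g) {z₀ : ℝ × ℝ}
  (hz₀ : z₀ ∈ J₁ ×ˢ J₂)
include h hz₀

/-- A product is reflected twice in the same hyperplane. -/
theorem isInvertedProduct_of_factor_eq_one (hρ : ∀ z ∈ J₁ ×ˢ J₂, ρ z = 1) :
    IsInvertedProduct J₁ J₂ g := by
  have hnet : IsTranslationNet J₁ J₂ g := (h.isTranslationNet_center 0).congr fun z hz => by
    simp only [hρ z hz, one_smul, sub_zero, add_zero]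
  obtain ⟨N₁, N₂, Φ, α, β, hα, hβ, hg⟩ := h.exists_product hρ hnet hz₀
  let v := fderiv ℝ g z₀ (1, 0)
  have hv : ‖v‖ = 1 := by
    rw [norm_eq_sqrt_real_inner, h.inner_fst z₀ hz₀, hρ z₀ hz₀, one_pow, inv_one, Real.sqrt_one]
  let S := (ℝ ∙ v)ᗮ.reflection
  have hS (x) : S x = x - (2 * inner ℝ v (x - 0)) • v := by
    rw [Submodule.reflection_orthogonal_apply, Submodule.reflection_singleton_apply, hv, sub_zero]
    simp only [RCLike.ofReal_real_eq_id, id_eq, one_pow, div_one]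
    module
  refine ⟨N₁, N₂, Φ.trans S.toIsometryEquiv, fun x => x - (2 * inner ℝ v (x - 0)) • v, α, β, hα, hβ,
    Or.inr ⟨0, v, hv, rfl⟩, fun s hs t ht => ?_⟩
  refine Eq.trans ?_ (hS _)
  exact (hg s hs t ht).trans (Submodule.reflection_reflection _ _).symm

theorem isInvertedProduct_of_center {y : E N} {R : ℝ} (hR : 0 < R)
    (hy : ∀ z ∈ J₁ ×ˢ J₂, ρ z * ‖g z - y‖ ^ 2 = R ^ 2) : IsInvertedProduct J₁ J₂ g := by
  have hne (z) (hz : z ∈ J₁ ×ˢ J₂) : g z ≠ y := fun heq => by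
    have hzero := hy z hz
    rw [heq, sub_self, norm_zero, zero_pow two_ne_zero, mul_zero] at hzero
    exact (pow_pos hR 2).ne hzero
  have hfactor (z) (hz : z ∈ J₁ ×ˢ J₂) : (R / dist (g z) y) ^ 2 = ρ z := by
    rw [div_pow, ← hy z hz, dist_eq_norm,
      mul_div_cancel_right₀ _ (pow_ne_zero 2 (norm_ne_zero_iff.2 (sub_ne_zero.2 (hne z hz))))]
  let I := EuclideanGeometry.inversion y R
  have hnet : IsTranslationNet J₁ J₂ (I ∘ g) := (h.isTranslationNet_center y).congr fun z hz => by
    simp only [← hfactor z hz]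
    rfl
  obtain ⟨N₁, N₂, Φ, α, β, hα, hβ, hg⟩ :=
    (h.toIsConformalNet.inversion hne hfactor).exists_product (fun _ _ => rfl) hnet hz₀
  have hI (s) (hs : s ∈ J₁) (t) (ht : t ∈ J₂) : I (Φ (WithLp.toLp 2 (α s, β t))) = g (s, t) := by
    rw [← hg s hs t ht]
    exact EuclideanGeometry.inversion_inversion y hR.ne' _
  refine ⟨N₁, N₂, Φ, I, α, β, hα, hβ, Or.inl ⟨y, R, hR, ?_, rfl⟩, fun s hs t ht =>
    (hI s hs t ht).symm⟩
  rintro ⟨s, hs, t, ht, hyst⟩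
  refine hne (s, t) ⟨hs, ht⟩ ?_
  rw [← hI s hs t ht, ← hyst]
  exact EuclideanGeometry.inversion_self y R

end IsIsothermicNet

end Products

section HypSphProducts

variable {m k N : ℕ} {J J₁ J₂ : Set ℝ} {c : ℝ}

theorem one_le_of_lor_self_pos {X : L m} (hX : 0 < lor X X) : 1 ≤ m := by
  by_contra! hm
  obtain rfl : m = 0 := Nat.lt_one_iff.1 hm
  rw [lor, Subsingleton.elim X.1 0, inner_zero_left, zero_sub] at hX
  exact (neg_pos.1 hX).not_ge (mul_self_nonneg X.2)

theorem IsUnitSpeedSph.one_le (hc : 0 < c) {β : ℝ → E (k + 1)} (hJ : IsOpen J)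
    (hβ : IsUnitSpeedSph c β J) {t : ℝ} (ht : t ∈ J) : 1 ≤ k := by
  by_contra! hk
  obtain rfl : k = 0 := Nat.lt_one_iff.1 hk
  have hder := (differentiableAt_of_contDiffOn hβ.1.1 hJ ht).hasDerivAt
  have horth := (hder.inner ℝ hder).unique ((hasDerivAt_const t (1 / c)).congr_of_eventuallyEq
    (by filter_upwards [hJ.mem_nhds ht] with r hr using hβ.2 r hr))
  rw [real_inner_comm, ← two_mul, mul_eq_zero, or_iff_right two_ne_zero] at horth
  have hspeed : inner ℝ (deriv β t) (deriv β t) = 1 := by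
    rw [real_inner_self_eq_norm_sq, hβ.1.2 t ht, one_pow]
  have hradius : inner ℝ (β t) (β t) = 1 / c := hβ.2 t ht
  simp only [PiLp.inner_apply, Fin.sum_univ_succ, Finset.univ_eq_empty, Finset.sum_empty,
    add_zero, RCLike.inner_apply, RCLike.conj_to_real] at horth hspeed hradius
  rcases mul_eq_zero.1 horth with h | h
  · rw [h, zero_mul] at hradius
    exact (one_div_pos.2 hc).ne hradius
  · rw [h, zero_mul] at hspeed
    exact zero_ne_one hspeed

theorem snd_pos_of_timelike (hJ : J.OrdConnected) {α : ℝ → L m} (hα : ContinuousOn α J)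
    (hneg : ∀ s ∈ J, lor (α s) (α s) < 0) {s₀ : ℝ} (hs₀ : s₀ ∈ J) (hpos : 0 < (α s₀).2) {s : ℝ}
    (hs : s ∈ J) : 0 < (α s).2 := by
  by_contra! hle
  obtain ⟨r, hr, hr0⟩ := hJ.isPreconnected.intermediate_value hs hs₀
    (continuous_snd.comp_continuousOn hα) ⟨hle, hpos.le⟩
  refine snd_ne_zero_of_causal (hneg r hr).le (fun h0 => ?_) hr0
  exact (hneg r hr).ne (by rw [h0, lor_zero_left])

theorem exists_radius (h₂ : IsOpen J₂) {W : Submodule ℝ (L (N + 1))} (hW : IsSpacelike W)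
    {a b : ℝ → L (N + 1)} {s₀ t₀ : ℝ} (hs₀ : s₀ ∈ J₁) (ht₀ : t₀ ∈ J₂)
    (haW : ∀ s ∈ J₁, a s ∈ (lorForm (N + 1)).orthogonal W) (hbW : ∀ t ∈ J₂, b t ∈ W)
    (hnull : ∀ s ∈ J₁, ∀ t ∈ J₂, lor (a s + b t) (a s + b t) = 0)
    (hdb : lor (deriv b t₀) (deriv b t₀) ≠ 0) :
    ∃ R, 0 < R ∧ (∀ s ∈ J₁, lor (a s) (a s) = -R) ∧ ∀ t ∈ J₂, lor (b t) (b t) = R := by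
  have hsum (s) (hs : s ∈ J₁) (t) (ht : t ∈ J₂) : lor (a s) (a s) + lor (b t) (b t) = 0 := by
    have horth : lor (b t) (a s) = 0 := haW s hs _ (hbW t ht)
    have hzero := hnull s hs t ht
    rwa [lor_add_self, lor_comm (a s) (b t), horth, mul_zero, add_zero] at hzero
  have hb (t) (ht : t ∈ J₂) : lor (b t) (b t) = lor (b t₀) (b t₀) :=
    add_left_cancel ((hsum s₀ hs₀ t ht).trans (hsum s₀ hs₀ t₀ ht₀).symm)
  refine ⟨_, hW _ (hbW t₀ ht₀) fun hzero => hdb ?_,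
    fun s hs => eq_neg_of_add_eq_zero_left (hsum s hs t₀ ht₀), hb⟩
  have hb0 (t) (ht : t ∈ J₂) : b t = 0 := by
    by_contra hne
    refine (hW _ (hbW t ht) hne).ne' ?_
    rw [hb t ht, hzero, lor_zero_left]
  have hconst : b =ᶠ[𝓝 t₀] fun _ => 0 := by
    filter_upwards [h₂.mem_nhds ht₀] with t ht using hb0 t ht
  rw [hconst.deriv_eq, deriv_const, lor_zero_left]

theorem exists_splitting_of_curves (h : IsBox J₁ J₂) {W : Submodule ℝ (L (N + 1))}
    {a b : ℝ → L (N + 1)} {R s₀ t₀ : ℝ} (hR : 0 < R) (hs₀ : s₀ ∈ J₁) (ht₀ : t₀ ∈ J₂)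
    (ha : ContDiffOn ℝ ∞ a J₁) (hb : ContDiffOn ℝ ∞ b J₂)
    (haW : ∀ s ∈ J₁, a s ∈ (lorForm (N + 1)).orthogonal W) (hbW : ∀ t ∈ J₂, b t ∈ W)
    (haa : ∀ s ∈ J₁, lor (a s) (a s) = -R) (hbb : ∀ t ∈ J₂, lor (b t) (b t) = R)
    (hda : ∀ s ∈ J₁, lor (deriv a s) (deriv a s) = 1)
    (hdb : ∀ t ∈ J₂, lor (deriv b t) (deriv b t) = 1) :
    ∃ (m k : ℕ) (c : ℝ) (S : Splitting m k N) (α : ℝ → L m) (β : ℝ → E (k + 1)),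
      1 ≤ m ∧ 1 ≤ k ∧ 0 < c ∧ IsUnitSpeedHyp c α J₁ ∧ IsUnitSpeedSph c β J₂ ∧
      ∀ s ∈ J₁, ∀ t ∈ J₂, S.toCone (α s, β t) = a s + b t := by
  have hWbot : W ≠ ⊥ := fun hbot => by
    have hzero := hbW t₀ ht₀
    rw [hbot, Submodule.mem_bot] at hzero
    exact hR.ne ((lor_zero_left (b t₀)).symm.trans (hzero ▸ hbb t₀ ht₀))
  have hneg : -R < 0 := neg_neg_of_pos hR
  obtain ⟨m, k, S, hD, hC, hτ⟩ :=
    exists_splitting_of_timelike hWbot ((haa s₀ hs₀).trans_lt hneg) (haW s₀ hs₀)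
  obtain ⟨α, sα, hα⟩ := exists_contDiffOn_lift h.isOpen_fst S.C ha fun s hs => hC (haW s hs)
  obtain ⟨β, sβ, hβ⟩ := exists_contDiffOn_lift h.isOpen_snd S.D hb fun t ht => hD (hbW t ht)
  have hαα (s) (hs : s ∈ J₁) : lor (α s) (α s) = -R := by rw [← S.lor_C, (hα s hs).1, haa s hs]
  have hdα (s) (hs : s ∈ J₁) : lor (deriv α s) (deriv α s) = 1 := by
    rw [← S.lor_C, (hα s hs).2, hda s hs]
  have hβ' : IsUnitSpeedSph (1 / R) β J₂ := by
    refine ⟨⟨sβ, fun t ht => ?_⟩, fun t ht => ?_⟩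
    · rw [norm_eq_sqrt_real_inner, ← S.lor_D, (hβ t ht).2, hdb t ht, Real.sqrt_one]
    · change inner ℝ (β t) (β t) = _
      rw [← S.lor_D, (hβ t ht).1, hbb t ht, one_div_one_div]
  refine ⟨m, k, 1 / R, S, α, β, one_le_of_lor_self_pos ((hdα s₀ hs₀).symm ▸ one_pos),
    hβ'.one_le (one_div_pos.2 hR) h.isOpen_snd ht₀, one_div_pos.2 hR,
    ⟨sα, fun s hs => ⟨⟨?_, ?_⟩, hdα s hs⟩⟩, hβ', fun s hs t ht => ?_⟩
  · rw [hαα s hs, neg_div, one_div_one_div]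
  · exact snd_pos_of_timelike h.ordConnected_fst sα.continuousOn
      (fun r hr => (hαα r hr).trans_lt hneg) hs₀ (hτ _ (hα s₀ hs₀).1) hs
  · rw [Splitting.toCone, (hα s hs).1, (hβ t ht).1]

/-- `g` is the composition of a product of curves of unit speed in `ℍ^m(-c)` and `𝕊^k(c)` with a
conformal diffeomorphism `Θ`. -/
def IsHypSphProduct (J₁ J₂ : Set ℝ) (g : ℝ × ℝ → E N) : Prop :=
  ∃ (m k : ℕ) (c : ℝ) (T : Triple N) (S : Splitting m k N) (α : ℝ → L m) (β : ℝ → E (k + 1)),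
    1 ≤ m ∧ 1 ≤ k ∧ 0 < c ∧
    IsUnitSpeedHyp c α J₁ ∧ IsUnitSpeedSph c β J₂ ∧
    ∀ s ∈ J₁, ∀ t ∈ J₂, lor (S.toCone (α s, β t)) T.w ≠ 0 ∧
      g (s, t) = Theta T S (α s, β t)

theorem IsSpacelike.exists_orthogonal_translates {n : ℕ} {A B : Set (L n)}
    (hB : IsSpacelike (Submodule.span ℝ B)) (hAB : ∀ x ∈ A, ∀ y ∈ B, lor x y = 0) (u : L n) :
    ∃ v w, v + w = u ∧ (∀ x ∈ A, x + v ∈ (lorForm n).orthogonal (Submodule.span ℝ B)) ∧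
      ∀ y ∈ B, y + w ∈ Submodule.span ℝ B := by
  obtain ⟨w, v, hw, hv, rfl⟩ :=
    Submodule.codisjoint_iff_exists_add_eq.1 hB.isCompl_orthogonal.codisjoint u
  refine ⟨v, w, add_comm v w, fun x hx => add_mem (fun y hy => ?_) hv,
    fun y hy => add_mem (Submodule.subset_span hy) hw⟩
  exact (lor_comm y x).trans
    (lor_eq_zero_of_mem_span hAB (Submodule.subset_span hx) hy)

theorem IsIsothermicNet.isHypSphProduct {ρ : ℝ × ℝ → ℝ} {g : ℝ × ℝ → E N}
    (h : IsIsothermicNet J₁ J₂ ρ g) (T : Triple N) {s₀ t₀ : ℝ} (hs₀ : s₀ ∈ J₁) (ht₀ : t₀ ∈ J₂)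
    (hW : IsSpacelike (Submodule.span ℝ
      ((fun t => T.lift ρ g (s₀, t) - T.lift ρ g (s₀, t₀)) '' J₂))) :
    IsHypSphProduct J₁ J₂ g := by
  let U := T.lift ρ g
  have sU : ContDiffOn ℝ ∞ U (J₁ ×ˢ J₂) := h.contDiffOn_lift T
  obtain ⟨v, w, hvw, hv, hw⟩ := hW.exists_orthogonal_translates
    (A := (fun s => U (s, t₀) - U (s₀, t₀)) '' J₁) (by
      rintro _ ⟨s, hs, rfl⟩ _ ⟨t, ht, rfl⟩
      exact h.lor_lift_sub_lift_sub T hs hs₀ ht ht₀) (U (s₀, t₀))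
  let a : ℝ → L (N + 1) := fun s => U (s, t₀) - U (s₀, t₀) + v
  let b : ℝ → L (N + 1) := fun t => U (s₀, t) - U (s₀, t₀) + w
  have haW (s) (hs : s ∈ J₁) := hv _ (mem_image_of_mem _ hs)
  have hbW (t) (ht : t ∈ J₂) := hw _ (mem_image_of_mem _ ht)
  have hab (s) (hs : s ∈ J₁) (t) (ht : t ∈ J₂) : a s + b t = U (s, t) := by
    calc a s + b t = U (s, t₀) + U (s₀, t) - U (s₀, t₀) - U (s₀, t₀) + (v + w) := by
          simp only [a, b]
          abel
      _ = U (s, t₀) + U (s₀, t) - U (s₀, t₀) := by rw [hvw, sub_add_cancel]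
      _ = U (s, t) := ((h.isTranslationNet_lift T).eq_add_sub hs hs₀ ht ht₀).symm
  have hda (s) (hs : s ∈ J₁) : lor (deriv a s) (deriv a s) = 1 := by
    rw [(((h.hasDerivAt_fst sU hs ht₀).sub_const _).add_const v).deriv,
      h.lor_fderiv_lift_fst T ⟨hs, ht₀⟩]
  have hdb (t) (ht : t ∈ J₂) : lor (deriv b t) (deriv b t) = 1 := by
    rw [(((h.hasDerivAt_snd sU hs₀ ht).sub_const _).add_const w).deriv,
      h.lor_fderiv_lift_snd T ⟨hs₀, ht⟩]
  obtain ⟨R, hR, haa, hbb⟩ := exists_radius h.isOpen_snd hW hs₀ ht₀ haW hbW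
    (fun s hs t ht => by rw [hab s hs t ht, T.lor_lift_self]) (hdb t₀ ht₀ ▸ one_ne_zero)
  obtain ⟨m, k, c, S, α, β, hm, hk, hc, hα, hβ, hS⟩ := exists_splitting_of_curves h.toIsBox hR hs₀
    ht₀ (((IsBox.contDiffOn_fst sU ht₀).sub contDiffOn_const).add contDiffOn_const)
    (((IsBox.contDiffOn_snd sU hs₀).sub contDiffOn_const).add contDiffOn_const) haW hbW haa hbb hda
    hdb
  refine ⟨m, k, c, T, S, α, β, hm, hk, hc, hα, hβ, fun s hs t ht => ?_⟩
  have hρ := (h.factor_pos (s, t) ⟨hs, ht⟩).ne'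
  have hcone : S.toCone (α s, β t) = ρ (s, t) • T.Psi (g (s, t)) :=
    (hS s hs t ht).trans (hab s hs t ht)
  constructor
  · rwa [hcone, lor_smul_left, T.lor_Psi_w, mul_one]
  · rw [Theta, hcone, T.toEuclidean_smul_Psi hρ]

end HypSphProducts

section Classification

variable {N : ℕ} {J₁ J₂ : Set ℝ} {ρ : ℝ × ℝ → ℝ} {g : ℝ × ℝ → E N} {z₀ : ℝ × ℝ}

theorem IsConformalNet.exists_ne (h : IsConformalNet J₁ J₂ ρ g) (hz₀ : z₀ ∈ J₁ ×ˢ J₂) (y : E N) :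
    ∃ z ∈ J₁ ×ˢ J₂, g z ≠ y := by
  by_contra! hy
  have hconst : g =ᶠ[𝓝 z₀] fun _ => y := by
    filter_upwards [h.isOpen_prod.mem_nhds hz₀] with z hz using hy z hz
  have hzero := h.inner_fst z₀ hz₀
  rw [hconst.fderiv_eq, fderiv_const_apply, zero_apply, inner_zero_left] at hzero
  exact inv_ne_zero (pow_ne_zero 2 (h.factor_pos z₀ hz₀).ne') hzero.symm

namespace IsIsothermicNet

variable (h : IsIsothermicNet J₁ J₂ ρ g) (hz₀ : z₀ ∈ J₁ ×ˢ J₂) (hρ₀ : ρ z₀ = 1)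
include h hz₀ hρ₀

theorem isInvertedProduct_of_null {ν : L (N + 1)} (hν : ν ≠ 0) (hνν : lor ν ν = 0)
    (hconst : ∀ z ∈ J₁ ×ˢ J₂,
      lor ((stdTriple N).lift ρ g z) ν = lor ((stdTriple N).lift ρ g z₀) ν) :
    IsInvertedProduct J₁ J₂ g := by
  simp only [Triple.lift, lor_smul_left, hρ₀, one_mul] at hconst
  rcases exists_eq_smul_of_lor_self_eq_zero hνν with ⟨a, y, rfl⟩ | ⟨b, rfl⟩
  · simp only [lor_smul_right, Triple.lor_Psi_Psi] at hconst
    have ha : a ≠ 0 := fun ha => hν (by rw [ha, zero_smul])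
    have hy (z) (hz : z ∈ J₁ ×ˢ J₂) : ρ z * ‖g z - y‖ ^ 2 = ‖g z₀ - y‖ ^ 2 :=
      mul_left_cancel₀ ha (by linear_combination -2 * hconst z hz)
    refine h.isInvertedProduct_of_center hz₀ (norm_pos_iff.2 fun hzero => ?_) hy
    obtain ⟨z, hz, hne⟩ := h.exists_ne hz₀ y
    refine mul_ne_zero (h.factor_pos z hz).ne'
      (pow_ne_zero 2 (norm_ne_zero_iff.2 (sub_ne_zero.2 hne))) ((hy z hz).trans ?_)
    rw [hzero, norm_zero, zero_pow two_ne_zero]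
  · have hb : b ≠ 0 := fun hb => hν (by rw [hb, zero_smul])
    refine h.isInvertedProduct_of_factor_eq_one hz₀ fun z hz => mul_right_cancel₀ hb ?_
    simpa only [lor_smul_right, Triple.lor_Psi_w, mul_one, one_mul] using hconst z hz

/-- If neither coordinate curve of the lift spans a space-like subspace, the two orthogonal spans
have a light-like direction in common. -/
theorem isInvertedProduct_or_isHypSphProduct :
    IsInvertedProduct J₁ J₂ g ∨ IsHypSphProduct J₁ J₂ g ∨
      IsHypSphProduct J₂ J₁ (g ∘ Prod.swap) := by
  obtain ⟨s₀, t₀⟩ := z₀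
  obtain ⟨hs₀ : s₀ ∈ J₁, ht₀ : t₀ ∈ J₂⟩ := hz₀
  let T := stdTriple N
  let p : ℝ → L (N + 1) := fun s => T.lift ρ g (s, t₀) - T.lift ρ g (s₀, t₀)
  let q : ℝ → L (N + 1) := fun t => T.lift ρ g (s₀, t) - T.lift ρ g (s₀, t₀)
  by_cases hq : IsSpacelike (Submodule.span ℝ (q '' J₂))
  · exact Or.inr (Or.inl (h.isHypSphProduct T hs₀ ht₀ hq))
  by_cases hp : IsSpacelike (Submodule.span ℝ (p '' J₁))
  · exact Or.inr (Or.inr (h.comp_swap.isHypSphProduct T ht₀ hs₀ hp))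
  left
  simp only [IsSpacelike, not_forall, not_lt] at hp hq
  obtain ⟨u, hu, hu0, hu_causal⟩ := hp
  obtain ⟨v, hv, hv0, hv_causal⟩ := hq
  have hpq : ∀ x ∈ p '' J₁, ∀ y ∈ q '' J₂, lor x y = 0 := by
    rintro _ ⟨s, hs, rfl⟩ _ ⟨t, ht, rfl⟩
    exact h.lor_lift_sub_lift_sub T hs hs₀ ht ht₀
  have hmem {A : Set (L (N + 1))} {x} (hx : x ∈ A) := Submodule.subset_span (R := ℝ) hx
  have hvu : lor v u = 0 := (lor_comm v u).trans (lor_eq_zero_of_mem_span hpq hu hv)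
  have horth {X} (hX : lor v X = 0) : lor u X = 0 :=
    orthogonal_of_causal hu_causal hv_causal hv0 ((lor_comm u v).trans hvu) hX
  refine h.isInvertedProduct_of_null ⟨hs₀, ht₀⟩ hρ₀ hu0 (horth hvu) ?_
  rintro ⟨s, t⟩ ⟨hs, ht⟩
  have hup : lor u (p s) = 0 := horth ((lor_comm v (p s)).trans
    (lor_eq_zero_of_mem_span hpq (hmem (mem_image_of_mem p hs)) hv))
  have huq : lor u (q t) = 0 := lor_eq_zero_of_mem_span hpq hu (hmem (mem_image_of_mem q ht))
  rw [lor_sub_right, sub_eq_zero] at hup huq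
  rw [(h.isTranslationNet_lift T).eq_add_sub hs hs₀ ht ht₀, lor_comm, lor_comm _ u, lor_sub_right,
    lor_add_right, hup, huq, add_sub_cancel_right]

end IsIsothermicNet

end Classification

/-! ### Local representatives of a surface -/

section Transition

theorem normalProj_fderiv {N : ℕ} (F : E 2 → E N) (x v : E 2) :
    normalProj F x (fderiv ℝ F x v) = 0 :=
  normalProj_eq_zero fun _ hη => (real_inner_comm _ _).trans (hη v)

theorem normalProj_fderiv_fderiv_comp {N : ℕ} {G : Type*} [NormedAddCommGroup G] [NormedSpace ℝ G]
    {F : E 2 → E N} {τ : G → E 2} {x : G} (hF : ContDiffAt ℝ ∞ F (τ x)) (hτ : ContDiffAt ℝ ∞ τ x)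
    (u v : G) :
    normalProj F (τ x) (D² (F ∘ τ) x u v)
      = normalProj F (τ x) (D² F (τ x) (fderiv ℝ τ x u) (fderiv ℝ τ x v)) := by
  have hchain : fderiv ℝ (F ∘ τ) =ᶠ[𝓝 x] fun y => (fderiv ℝ F (τ y)).comp (fderiv ℝ τ y) := by
    have hF₁ := (hF.of_le (show (1 : WithTop ℕ∞) ≤ ∞ by simp)).eventually (by simp)
    have hτ₁ := (hτ.of_le (show (1 : WithTop ℕ∞) ≤ ∞ by simp)).eventually (by simp)
    filter_upwards [hτ.continuousAt.eventually hF₁, hτ₁] with y hFy hτy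
    exact fderiv_comp y (hFy.differentiableAt (by simp)) (hτy.differentiableAt (by simp))
  have hDF : HasFDerivAt (fun y => fderiv ℝ F (τ y)) ((D² F (τ x)).comp (fderiv ℝ τ x)) x :=
    ((hF.fderiv_right (m := ∞) (by simp)).differentiableAt (by simp)).hasFDerivAt.comp x
      (hτ.differentiableAt (by simp)).hasFDerivAt
  have hDτ := ((hτ.fderiv_right (m := ∞) (by simp)).differentiableAt (by simp)).hasFDerivAt
  have hsecond : D² (F ∘ τ) x u v = fderiv ℝ F (τ x) (D² τ x u v)
      + D² F (τ x) (fderiv ℝ τ x u) (fderiv ℝ τ x v) := by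
    rw [hchain.fderiv_eq, (hDF.clm_comp hDτ).fderiv]
    simp
  have htang := normalProj_fderiv F (τ x) (D² τ x u v)
  simp only [normalProj] at htang ⊢
  rw [hsecond, map_add, htang, zero_add]

variable {N : ℕ} {M : Type*} [TopologicalSpace M] [ChartedSpace (E 2) M]

/-- The change of coordinates from the preferred chart at `p` to that at the point with
coordinates `x`. Its differential at `x` takes coordinate vectors to tangent vectors of `M`, since
Mathlib identifies `T_q M` with `ℝ²` through the preferred chart at `q`. -/
def coordChange (p : M) (x : E 2) : E 2 → E 2 :=
  extChartAt (𝓡 2) ((extChartAt (𝓡 2) p).symm x) ∘ (extChartAt (𝓡 2) p).symm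

variable {f : M → E N} {p : M} {x : E 2}

theorem diff_eq (hf : IsSmoothImmersion f) (q : M) :
    diff f q = fderiv ℝ (localRep f q) (extChartAt (𝓡 2) q q) := by
  rw [diff, ((hf.1 q).mdifferentiableAt (by simp)).mfderiv, ModelWithCorners.range_eq_univ,
    fderivWithin_univ]
  rfl

theorem localRep_eventuallyEq (f : M → E N) (hx : x ∈ (extChartAt (𝓡 2) p).target) :
    localRep f p =ᶠ[𝓝 x] localRep f ((extChartAt (𝓡 2) p).symm x) ∘ coordChange p x := by
  have hcont : ContinuousAt (extChartAt (𝓡 2) p).symm x := continuousAt_extChartAt_symm'' hx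
  filter_upwards [hcont (extChartAt_source_mem_nhds (I := 𝓡 2) ((extChartAt (𝓡 2) p).symm x))]
    with y hy
  simp only [localRep, coordChange, Function.comp_apply]
  rw [PartialEquiv.left_inv _ hy]

variable [IsManifold (𝓡 2) ∞ M]

theorem contDiffAt_coordChange (hx : x ∈ (extChartAt (𝓡 2) p).target) :
    ContDiffAt ℝ ∞ (coordChange p x) x := by
  have hsource : x ∈ ((extChartAt (𝓡 2) p).symm ≫
      extChartAt (𝓡 2) ((extChartAt (𝓡 2) p).symm x)).source := by
    rw [PartialEquiv.trans_source, PartialEquiv.symm_source]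
    exact ⟨hx, mem_extChartAt_source _⟩
  have hsmooth := contDiffWithinAt_ext_coord_change (I := 𝓡 2) (n := ∞) _ p hsource
  rwa [ModelWithCorners.range_eq_univ, contDiffWithinAt_univ] at hsmooth

theorem mdifferentiableAt_chart_symm (hx : x ∈ (extChartAt (𝓡 2) p).target) :
    MDifferentiableAt 𝓘(ℝ, E 2) (𝓡 2) (extChartAt (𝓡 2) p).symm x :=
  ((contMDiffOn_extChartAt_symm (n := ∞) p).contMDiffAt
    ((isOpen_extChartAt_target p).mem_nhds hx)).mdifferentiableAt (by simp)

theorem mfderiv_chart_symm (hx : x ∈ (extChartAt (𝓡 2) p).target) :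
    mfderiv 𝓘(ℝ, E 2) (𝓡 2) (extChartAt (𝓡 2) p).symm x = fderiv ℝ (coordChange p x) x := by
  rw [(mdifferentiableAt_chart_symm hx).mfderiv, ModelWithCorners.range_eq_univ,
    fderivWithin_univ]
  rfl

theorem mfderiv_chart_symm_comp {G : Type*} [NormedAddCommGroup G] [NormedSpace ℝ G]
    {c : G → E 2} {z : G} (hz : c z ∈ (extChartAt (𝓡 2) p).target) (hc : DifferentiableAt ℝ c z)
    (v : G) :
    mfderiv 𝓘(ℝ, G) (𝓡 2) ((extChartAt (𝓡 2) p).symm ∘ c) z v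
      = fderiv ℝ (coordChange p (c z)) (c z) (fderiv ℝ c z v) := by
  have hchain := mfderiv_comp (I := 𝓘(ℝ, G)) (I' := 𝓘(ℝ, E 2)) (I'' := 𝓡 2) z
    (mdifferentiableAt_chart_symm hz) hc.mdifferentiableAt
  rw [mfderiv_chart_symm hz, mfderiv_eq_fderiv] at hchain
  exact DFunLike.congr_fun hchain v

theorem fderiv_coordChange_surjective (hx : x ∈ (extChartAt (𝓡 2) p).target) :
    Function.Surjective (fderiv ℝ (coordChange p x) x) := by
  have : IsManifold (𝓡 2) 1 M := IsManifold.of_le (n := ∞) (by simp)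
  have hinv := isInvertible_mfderivWithin_extChartAt_symm (I := 𝓡 2) hx
  rw [ModelWithCorners.range_eq_univ, mfderivWithin_univ, mfderiv_chart_symm hx] at hinv
  exact hinv.bijective.surjective

theorem contDiffOn_localRep (hf : IsSmoothImmersion f) (p : M) :
    ContDiffOn ℝ ∞ (localRep f p) (extChartAt (𝓡 2) p).target :=
  contMDiffOn_iff_contDiffOn.1 (hf.1.comp_contMDiffOn (contMDiffOn_extChartAt_symm p))

theorem contDiffAt_localRep_self (hf : IsSmoothImmersion f) (q : M) :
    ContDiffAt ℝ ∞ (localRep f q) (extChartAt (𝓡 2) q q) :=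
  (contDiffOn_localRep hf q).contDiffAt (extChartAt_target_mem_nhds q)

theorem fderiv_localRep (hf : IsSmoothImmersion f) (hx : x ∈ (extChartAt (𝓡 2) p).target)
    (v : E 2) :
    fderiv ℝ (localRep f p) x v
      = fderiv ℝ (localRep f ((extChartAt (𝓡 2) p).symm x))
        (extChartAt (𝓡 2) ((extChartAt (𝓡 2) p).symm x) ((extChartAt (𝓡 2) p).symm x))
        (fderiv ℝ (coordChange p x) x v) := by
  rw [(localRep_eventuallyEq f hx).fderiv_eq, fderiv_comp]
  · rfl
  · exact (contDiffAt_localRep_self hf _).differentiableAt (by simp)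
  · exact (contDiffAt_coordChange hx).differentiableAt (by simp)

theorem diff_coordChange (hf : IsSmoothImmersion f) (hx : x ∈ (extChartAt (𝓡 2) p).target)
    (v : E 2) :
    diff f ((extChartAt (𝓡 2) p).symm x) (fderiv ℝ (coordChange p x) x v)
      = fderiv ℝ (localRep f p) x v := by
  rw [diff_eq hf, fderiv_localRep hf hx]
  rfl

theorem metric_coordChange (hf : IsSmoothImmersion f) (hx : x ∈ (extChartAt (𝓡 2) p).target)
    (u v : E 2) :
    metric f ((extChartAt (𝓡 2) p).symm x) (fderiv ℝ (coordChange p x) x u)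
        (fderiv ℝ (coordChange p x) x v)
      = inner ℝ (fderiv ℝ (localRep f p) x u) (fderiv ℝ (localRep f p) x v) := by
  rw [← diff_coordChange hf hx, ← diff_coordChange hf hx]
  rfl

theorem range_fderiv_localRep (hf : IsSmoothImmersion f) (hx : x ∈ (extChartAt (𝓡 2) p).target) :
    LinearMap.range (fderiv ℝ (localRep f ((extChartAt (𝓡 2) p).symm x))
        (extChartAt (𝓡 2) ((extChartAt (𝓡 2) p).symm x)
          ((extChartAt (𝓡 2) p).symm x))).toLinearMap
      = LinearMap.range (fderiv ℝ (localRep f p) x).toLinearMap := by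
  ext y
  constructor
  · rintro ⟨v, rfl⟩
    obtain ⟨u, rfl⟩ := fderiv_coordChange_surjective hx v
    exact ⟨u, fderiv_localRep hf hx u⟩
  · rintro ⟨u, rfl⟩
    exact ⟨_, (fderiv_localRep hf hx u).symm⟩

theorem tangentProj_localRep (hf : IsSmoothImmersion f) (hx : x ∈ (extChartAt (𝓡 2) p).target)
    (v : E N) :
    tangentProj (localRep f ((extChartAt (𝓡 2) p).symm x))
        (extChartAt (𝓡 2) ((extChartAt (𝓡 2) p).symm x) ((extChartAt (𝓡 2) p).symm x)) v
      = tangentProj (localRep f p) x v := by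
  simp only [tangentProj, range_fderiv_localRep hf hx]

theorem normalProj_localRep (hf : IsSmoothImmersion f) (hx : x ∈ (extChartAt (𝓡 2) p).target)
    (v : E N) :
    normalProj (localRep f ((extChartAt (𝓡 2) p).symm x))
        (extChartAt (𝓡 2) ((extChartAt (𝓡 2) p).symm x) ((extChartAt (𝓡 2) p).symm x)) v
      = normalProj (localRep f p) x v := by
  simp only [normalProj, range_fderiv_localRep hf hx]

theorem sff_coordChange (hf : IsSmoothImmersion f) (hx : x ∈ (extChartAt (𝓡 2) p).target)
    (u v : E 2) :
    sff f ((extChartAt (𝓡 2) p).symm x) (fderiv ℝ (coordChange p x) x u)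
        (fderiv ℝ (coordChange p x) x v)
      = normalProj (localRep f p) x (D² (localRep f p) x u v) := by
  rw [((localRep_eventuallyEq f hx).fderiv (𝕜 := ℝ)).fderiv_eq (𝕜 := ℝ),
    ← normalProj_localRep hf hx]
  exact (normalProj_fderiv_fderiv_comp (τ := coordChange p x) (contDiffAt_localRep_self hf _)
    (contDiffAt_coordChange hx) u v).symm

theorem fderiv_localRep_injective (hf : IsSmoothImmersion f)
    (hx : x ∈ (extChartAt (𝓡 2) p).target) : Function.Injective (fderiv ℝ (localRep f p) x) := by
  intro u v huv
  rw [← diff_coordChange hf hx, ← diff_coordChange hf hx] at huv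
  exact LinearMap.injective_iff_surjective.2 (fderiv_coordChange_surjective hx) (hf.2 _ huv)

theorem not_umbilic_localRep (hf : IsSmoothImmersion f) (hx : x ∈ (extChartAt (𝓡 2) p).target)
    (hu : ¬ IsUmbilic f ((extChartAt (𝓡 2) p).symm x)) :
    ¬ ∃ H : E N, ∀ u v, normalProj (localRep f p) x (D² (localRep f p) x u v)
      = inner ℝ (fderiv ℝ (localRep f p) x u) (fderiv ℝ (localRep f p) x v) • H := by
  rintro ⟨H, hH⟩
  refine hu ⟨H, fun Z Z' => ?_⟩
  obtain ⟨u, rfl⟩ := fderiv_coordChange_surjective hx Z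
  obtain ⟨v, rfl⟩ := fderiv_coordChange_surjective hx Z'
  rw [sff_coordChange hf hx, metric_coordChange hf hx, hH]

end Transition

/-! ### Curvature lines and isothermic parametrizations -/

section Parametrization

variable {N : ℕ} {M : Type*} [TopologicalSpace M] [ChartedSpace (E 2) M] [IsManifold (𝓡 2) ∞ M]
  {f : M → E N} {p : M} {x : E 2} {V : Set (E 2)} {X Y : E 2 → E 2}

theorem IsPrincipalFrame.isPrincipal_fst (h : IsPrincipalFrame (localRep f p) V X Y)
    (hf : IsSmoothImmersion f) (hV : V ⊆ (extChartAt (𝓡 2) p).target) (hx : x ∈ V) {a : ℝ}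
    (ha : a ≠ 0) :
    IsPrincipal f ((extChartAt (𝓡 2) p).symm x) (fderiv ℝ (coordChange p x) x (a • X x)) := by
  have hXX := h.inner_fst x hx
  constructor
  · intro hzero
    have hdiff := diff_coordChange hf (hV hx) (a • X x)
    rw [hzero, map_zero, map_smul] at hdiff
    rw [push, (smul_eq_zero.1 hdiff.symm).resolve_left ha, inner_zero_left] at hXX
    exact zero_ne_one hXX
  · intro ξ _
    refine ⟨inner ℝ (normalProj (localRep f p) x (D² (localRep f p) x (X x) (X x))) ξ,
      fun Z => ?_⟩
    obtain ⟨v, rfl⟩ := fderiv_coordChange_surjective (hV hx) Z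
    have hconj := h.conjugate x hx
    have hXY := h.inner_fst_snd x hx
    rw [sff_coordChange hf (hV hx), metric_coordChange hf (hV hx), h.decomp hx v]
    simp only [normalProj] at hconj ⊢
    simp only [push] at hXX hXY ⊢
    simp only [map_add, map_smul, smul_apply, inner_add_right, real_inner_smul_left,
      real_inner_smul_right, hconj, hXX, hXY, smul_zero, add_zero, mul_zero, mul_one]
    ring

theorem IsFrame.geodesicCurvature_integralCurve (h : IsFrame (localRep f p) V X Y)
    (hf : IsSmoothImmersion f) (hV : V ⊆ (extChartAt (𝓡 2) p).target) {c : ℝ → E 2} {J : Set ℝ}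
    (hJ : IsOpen J) (hcV : ∀ t ∈ J, c t ∈ V) (hc : ∀ t ∈ J, HasDerivAt c (X (c t)) t) {t : ℝ}
    (ht : t ∈ J) :
    geodesicCurvature f ((extChartAt (𝓡 2) p).symm ∘ c) t
      = |geodCurv (localRep f p) X Y (c t)| := by
  have hct := hcV t ht
  have hderiv : deriv (f ∘ (extChartAt (𝓡 2) p).symm ∘ c) =ᶠ[𝓝 t] push (localRep f p) X ∘ c := by
    filter_upwards [hJ.mem_nhds ht] with s hs
    exact ((differentiableAt_of_contDiffOn h.smooth h.isOpen
      (hcV s hs)).hasFDerivAt.comp_hasDerivAt s (hc s hs)).deriv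
  have hderiv₂ : deriv (deriv (f ∘ (extChartAt (𝓡 2) p).symm ∘ c)) t
      = fderiv ℝ (push (localRep f p) X) (c t) (X (c t)) := by
    rw [hderiv.deriv_eq]
    exact ((differentiableAt_of_contDiffOn h.contDiffOn_push_fst h.isOpen
      hct).hasFDerivAt.comp_hasDerivAt t (hc t ht)).deriv
  have hgeod : geodesicCurvature f ((extChartAt (𝓡 2) p).symm ∘ c) t
      = ‖tangentProj (localRep f p) (c t)
        (deriv (deriv (f ∘ (extChartAt (𝓡 2) p).symm ∘ c)) t)‖ := by
    rw [← tangentProj_localRep hf (hV hct)]; rfl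
  rw [hgeod, hderiv₂, h.tangentProj_eq hct, h.inner_fderiv_push_fst hct, zero_smul, zero_add,
    norm_smul, norm_eq_sqrt_real_inner (push (localRep f p) Y (c t)), h.inner_snd _ hct,
    Real.sqrt_one, mul_one, Real.norm_eq_abs]
  rfl

theorem IsPrincipalFrame.isCurvatureLine (h : IsPrincipalFrame (localRep f p) V X Y)
    (hf : IsSmoothImmersion f) (hV : V ⊆ (extChartAt (𝓡 2) p).target) {c : ℝ → E 2} {J : Set ℝ}
    (hJ : IsOpen J) (hJ' : J.OrdConnected) (hcV : ∀ t ∈ J, c t ∈ V)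
    (hc : ∀ t ∈ J, HasDerivAt c (X (c t)) t) :
    IsCurvatureLine f ((extChartAt (𝓡 2) p).symm ∘ c) J := by
  refine ⟨hJ, hJ', (contMDiffOn_extChartAt_symm p).comp (contMDiffOn_iff_contDiffOn.2
    (contDiffOn_integralCurve h.smooth_fst hJ hcV hc)) fun t ht => hV (hcV t ht), fun t ht => ?_⟩
  have hct := hcV t ht
  have hvel : velocity ((extChartAt (𝓡 2) p).symm ∘ c) t
      = fderiv ℝ (coordChange p (c t)) (c t) ((1 : ℝ) • X (c t)) := by
    rw [one_smul, velocity, mfderiv_chart_symm_comp (hV hct) (hc t ht).differentiableAt,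
      ← (hc t ht).deriv, ← fderiv_apply_one_eq_deriv]
  rw [hvel]
  refine ⟨(congrArg norm (diff_coordChange hf (hV hct) _)).trans ?_,
    h.isPrincipal_fst hf hV hct one_ne_zero⟩
  rw [one_smul, norm_eq_sqrt_real_inner]
  exact Real.sqrt_eq_one.2 (h.inner_fst _ hct)

theorem IsPrincipalFrame.fderiv_geodCurv (h : IsPrincipalFrame (localRep f p) V X Y)
    (hf : IsSmoothImmersion f) (hgeod : CurvatureLinesHaveConstantGeodesicCurvature f)
    (hV : V ⊆ (extChartAt (𝓡 2) p).target) (x : E 2) (hx : x ∈ V) :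
    fderiv ℝ (geodCurv (localRep f p) X Y) x (X x) = 0 := by
  refine fderiv_eq_zero_of_abs_const h.isOpen h.smooth_fst
    (h.contDiffOn_geodCurv.differentiableOn (by simp)) (fun c J hJ hJ' hcV hc s hs t ht => ?_) hx
  rw [← h.geodesicCurvature_integralCurve hf hV hJ hcV hc hs,
    ← h.geodesicCurvature_integralCurve hf hV hJ hcV hc ht]
  exact hgeod _ J (h.isCurvatureLine hf hV hJ hJ' hcV hc) s hs t ht

variable {ρ : E 2 → ℝ} {J₁ J₂ : Set ℝ} {φ : OpenPartialHomeomorph (ℝ × ℝ) (E 2)}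

theorem IsIsothermicChart.comp_swap {F : E 2 → E N} (h : IsIsothermicChart F X Y ρ J₁ J₂ φ) :
    IsIsothermicChart F Y X ρ J₂ J₁ ((Homeomorph.prodComm ℝ ℝ).transOpenPartialHomeomorph φ) := by
  have hsource :
      ((Homeomorph.prodComm ℝ ℝ).transOpenPartialHomeomorph φ).source = J₂ ×ˢ J₁ := by
    change Prod.swap ⁻¹' φ.source = _
    rw [h.source_eq, preimage_swap_prod]
  have hc : ContDiffOn ℝ ∞ φ (J₁ ×ˢ J₂) := h.source_eq ▸ h.contDiffOn
  refine ⟨⟨h.toIsBox.swap, hsource, ?_,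
    (contDiff_snd.prodMk contDiff_fst).comp_contDiffOn h.contDiffOn_symm⟩, h.frame.swap,
    h.contDiffOn_factor, h.factor_pos, h.fderiv_factor_snd, h.fderiv_factor_fst,
    fun z hz => ?_, fun z hz => ?_⟩
  · rw [hsource]; exact contDiffOn_comp_swap hc
  · exact (fderiv_comp_swap φ z (1, 0)).trans (h.fderiv_snd _ hz)
  · exact (fderiv_comp_swap φ z (0, 1)).trans (h.fderiv_fst _ hz)

/-- The parametrization of a region of `M` whose expression in the preferred chart at `p` is `φ`. -/
def IsBoxChart.toPartialDiffeomorph (h : IsBoxChart J₁ J₂ φ)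
    (hφ : φ.target ⊆ (extChartAt (𝓡 2) p).target) :
    PartialDiffeomorph 𝓘(ℝ, ℝ × ℝ) (𝓡 2) (ℝ × ℝ) M ∞ where
  toFun z := (extChartAt (𝓡 2) p).symm (φ z)
  invFun q := φ.symm (extChartAt (𝓡 2) p q)
  source := φ.source
  target := (extChartAt (𝓡 2) p).source ∩ extChartAt (𝓡 2) p ⁻¹' φ.target
  map_source' z hz := by
    have hφz := φ.map_source hz
    refine ⟨(extChartAt (𝓡 2) p).map_target (hφ hφz), ?_⟩
    rwa [mem_preimage, (extChartAt (𝓡 2) p).right_inv (hφ hφz)]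
  map_target' q hq := φ.map_target hq.2
  left_inv' z hz := by
    rw [(extChartAt (𝓡 2) p).right_inv (hφ (φ.map_source hz)), φ.left_inv hz]
  right_inv' q hq := by
    rw [φ.right_inv hq.2, (extChartAt (𝓡 2) p).left_inv hq.1]
  open_source := φ.open_source
  open_target := (continuousOn_extChartAt p).isOpen_inter_preimage (isOpen_extChartAt_source p)
    φ.open_target
  contMDiffOn_toFun := (contMDiffOn_extChartAt_symm p).comp
    (contMDiffOn_iff_contDiffOn.2 h.contDiffOn) fun _ hz => hφ (φ.map_source hz)
  contMDiffOn_invFun := by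
    have hchart : ContMDiffOn (𝓡 2) 𝓘(ℝ, E 2) ∞ (extChartAt (𝓡 2) p)
        (extChartAt (𝓡 2) p).source := by
      rw [extChartAt_source]; exact contMDiffOn_extChartAt
    exact (contMDiffOn_iff_contDiffOn.2 h.contDiffOn_symm).comp (hchart.mono inter_subset_left)
      fun _ hq => hq.2

theorem IsBoxChart.coordVec_toPartialDiffeomorph (h : IsBoxChart J₁ J₂ φ)
    (hφ : φ.target ⊆ (extChartAt (𝓡 2) p).target) {z : ℝ × ℝ} (hz : z ∈ φ.source) (e : ℝ × ℝ) :
    coordVec (h.toPartialDiffeomorph hφ) z e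
      = fderiv ℝ (coordChange p (φ z)) (φ z) (fderiv ℝ φ z e) :=
  mfderiv_chart_symm_comp (hφ (φ.map_source hz))
    (differentiableAt_of_contDiffOn h.contDiffOn φ.open_source hz) e

namespace IsIsothermicChart

theorem isIsothermicAt (h : IsIsothermicChart (localRep f p) X Y ρ J₁ J₂ φ)
    (hf : IsSmoothImmersion f) (hφ : φ.target ⊆ (extChartAt (𝓡 2) p).target)
    (hp : extChartAt (𝓡 2) p p ∈ φ.target) :
    IsIsothermicAt f p J₁ J₂ (h.toPartialDiffeomorph hφ) := by
  refine ⟨h.isOpen_fst, h.ordConnected_fst, h.isOpen_snd, h.ordConnected_snd, h.source_eq,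
    ⟨mem_extChartAt_source p, hp⟩, fun z hz => ?_⟩
  rw [← h.source_eq] at hz
  have hx := φ.map_source hz
  have hρ : 0 < (ρ (φ z))⁻¹ := inv_pos.2 (h.factor_pos _ hx)
  rw [h.toIsBoxChart.coordVec_toPartialDiffeomorph hφ hz,
    h.toIsBoxChart.coordVec_toPartialDiffeomorph hφ hz, h.fderiv_fst z hz, h.fderiv_snd z hz]
  have hmetric (u v : E 2) (a b : ℝ) :
      metric f (h.toPartialDiffeomorph hφ z) (fderiv ℝ (coordChange p (φ z)) (φ z) (a • u))
          (fderiv ℝ (coordChange p (φ z)) (φ z) (b • v))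
        = a * b * inner ℝ (fderiv ℝ (localRep f p) (φ z) u)
          (fderiv ℝ (localRep f p) (φ z) v) := by
    refine (metric_coordChange hf (hφ hx) _ _).trans ?_
    rw [map_smul, map_smul, real_inner_smul_left, real_inner_smul_right, mul_assoc]
  refine ⟨⟨_, hρ, (hmetric ..).trans ?_, (hmetric ..).trans ?_, (hmetric ..).trans ?_⟩,
    h.frame.isPrincipal_fst hf hφ hx hρ.ne', h.frame.swap.isPrincipal_fst hf hφ hx hρ.ne'⟩
  · rw [sq]; exact mul_eq_left₀ (mul_pos hρ hρ).ne' |>.2 (h.frame.inner_fst _ hx)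
  · rw [sq]; exact mul_eq_left₀ (mul_pos hρ hρ).ne' |>.2 (h.frame.inner_snd _ hx)
  · exact mul_eq_zero_of_right _ (h.frame.inner_fst_snd _ hx)

theorem isInvertedProductAt (h : IsIsothermicChart (localRep f p) X Y ρ J₁ J₂ φ)
    (hf : IsSmoothImmersion f) (hφ : φ.target ⊆ (extChartAt (𝓡 2) p).target)
    (hp : extChartAt (𝓡 2) p p ∈ φ.target) (hg : IsInvertedProduct J₁ J₂ (localRep f p ∘ φ)) :
    IsInvertedProductAt f p :=
  ⟨J₁, J₂, h.toPartialDiffeomorph hφ, h.isIsothermicAt hf hφ hp, hg⟩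

theorem isHypSphProductAt (h : IsIsothermicChart (localRep f p) X Y ρ J₁ J₂ φ)
    (hf : IsSmoothImmersion f) (hφ : φ.target ⊆ (extChartAt (𝓡 2) p).target)
    (hp : extChartAt (𝓡 2) p p ∈ φ.target) (hg : IsHypSphProduct J₁ J₂ (localRep f p ∘ φ)) :
    IsHypSphProductAt f p :=
  ⟨J₁, J₂, h.toPartialDiffeomorph hφ, h.isIsothermicAt hf hφ hp, hg⟩

end IsIsothermicChart

end Parametrization

end

end Isothermic

theorem corollary4p3_general {N : ℕ} {M : Type*} [TopologicalSpace M]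
    [ChartedSpace (EuclideanSpace ℝ (Fin 2)) M] [IsManifold (𝓡 2) ∞ M]
    {f : M → EuclideanSpace ℝ (Fin N)} (hf : Isothermic.IsSmoothImmersion f)
    (hflat : Isothermic.HasFlatNormalBundle f)
    (hgeod : Isothermic.CurvatureLinesHaveConstantGeodesicCurvature f) {p : M}
    (hp : ¬ Isothermic.IsUmbilic f p) :
    Isothermic.IsInvertedProductAt f p ∨ Isothermic.IsHypSphProductAt f p := by
  have hx₀ := mem_extChartAt_target (I := 𝓡 2) p
  obtain ⟨X₀, Y₀, h₀⟩ := Isothermic.exists_isFrame (isOpen_extChartAt_target p)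
    (Isothermic.contDiffOn_localRep hf p) fun x hx => Isothermic.fderiv_localRep_injective hf hx
  obtain ⟨V, hV, hx₀V, X, Y, h⟩ := h₀.exists_isPrincipalFrame (hflat p) hx₀
    (Isothermic.not_umbilic_localRep hf hx₀ (by rwa [extChartAt_to_inv]))
  have hX := h.fderiv_geodCurv hf hgeod hV
  obtain ⟨ρ, J₁, J₂, φ, hφ, hφV, hx₀φ, hρ⟩ :=
    h.exists_isIsothermicChart hx₀V hX (h.swap.fderiv_geodCurv hf hgeod hV)
  have hz₀ : φ.symm (extChartAt (𝓡 2) p p) ∈ J₁ ×ˢ J₂ := hφ.source_eq ▸ φ.map_target hx₀φ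
  have hρ₀ : (ρ ∘ φ) (φ.symm (extChartAt (𝓡 2) p p)) = 1 := by
    rw [Function.comp_apply, φ.right_inv hx₀φ, hρ]
  have hφM := hφV.trans hV
  rcases (hφ.isIsothermicNet fun x hx => hX x (hφV hx)).isInvertedProduct_or_isHypSphProduct
    hz₀ hρ₀ with hg | hg | hg
  · exact .inl (hφ.isInvertedProductAt hf hφM hx₀φ hg)
  · exact .inr (hφ.isHypSphProductAt hf hφM hx₀φ hg)
  · exact .inr (hφ.comp_swap.isHypSphProductAt hf hφM hx₀φ hg)

theorem corollary4p3 {N : ℕ} {M : Type*} [TopologicalSpace M]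
    [ChartedSpace (EuclideanSpace ℝ (Fin 2)) M] [IsManifold (𝓡 2) ∞ M]
    (f : M → EuclideanSpace ℝ (Fin N)) (hf : Isothermic.IsSmoothImmersion f)
    (hflat : Isothermic.HasFlatNormalBundle f)
    (humb : ∀ p : M, ¬ Isothermic.IsUmbilic f p)
    (hgeod : Isothermic.CurvatureLinesHaveConstantGeodesicCurvature f) (p : M) :
    Isothermic.IsInvertedProductAt f p ∨ Isothermic.IsHypSphProductAt f p :=
  corollary4p3_general hf hflat hgeod (humb p)
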